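/- Let $\Bbbk$ be a field and let $\mathrm{Var}$ be a multilinear variety of $\Bbbk$-algebras, i.e. the class of all (not necessarily associative) $\Bbbk$-algebras with one bilinear operation that satisfy a given set of multilinear identities. Denote by $\mathrm{Var}$ also the corresponding symmetric operad: $\mathrm{Var}(n)$ is the space of multilinear nonassociative polynomials in $x_1,\dots,x_n$ modulo the identities of $\mathrm{Var}$, with composition given by substitution. Let $\mathrm{Nov}$ be the operad of Novikov algebras, which are defined by the identities $(a\circ b)\circ c-a\circ(b\circ c)=(b\circ a)\circ c-b\circ(a\circ c)$ and $(a\circ b)\circ c=(a\circ c)\circ b$. Let $\mathrm{Var}\circ\mathrm{Nov}$ be the Manin white product, i.e. the suboperad of the Hadamard product $(\mathrm{Var}(n)\otimes\mathrm{Nov}(n))_{n\ge 1}$ generated by $\mathrm{Var}(2)\otimes\mathrm{Nov}(2)$. Every $(\mathrm{Var}\circ\mathrm{Nov})$-algebra (algebra over this operad) has the two bilinear operations $$x_1\prec x_2 = x_1x_2\otimes (x_1\circ x_2),\qquad x_1\succ x_2 = x_1x_2\otimes (x_2\circ x_1).$$ A nonassociative polynomial $f(x_1,\dots,x_n)$ over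 $\Bbbk$ in two binary operations $\prec,\succ$ is called a derived identity of $\mathrm{Var}$ if for every $A\in\mathrm{Var}$ and every derivation $d$ of $A$ (a linear map with $d(ab)=d(a)b+a\,d(b)$) the identity $f=0$ holds on $A^{(d)}$, the space $A$ with the operations $a\prec b=a\,d(b)$ and $a\succ b=d(a)\,b$. Theorem. Let $f=f(x_1,\dots,x_n)$ be a derived identity of $\mathrm{Var}$ that is multilinear (each of $x_1,\dots,x_n$ occurs exactly once in every monomial of $f$). Then the identity $f=0$ holds on every $(\mathrm{Var}\circ\mathrm{Nov})$-algebra. -/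

import Mathlib

universe u v

/-! ### Symmetric operads -/

/-- The bijection identifying the distinguished point on the right with the distinguished point. -/
def optionSumRight (I J : Type) : I ⊕ Option J ≃ Option (I ⊕ J) where
  toFun
    | .inl i => some (.inl i)
    | .inr none => none
    | .inr (some j) => some (.inr j)
  invFun
    | none => .inr none
    | some (.inl i) => .inl i
    | some (.inr j) => .inr (some j)
  left_inv := by rintro (i | _ | j) <;> rfl
  right_inv := by rintro (_ | i | j) <;> rfl

/-- The bijection identifying the distinguished point on the left with the distinguished point. -/
def optionSumLeft (I J : Type) : Option I ⊕ J ≃ Option (I ⊕ J) where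
  toFun
    | .inl none => none
    | .inl (some i) => some (.inl i)
    | .inr j => some (.inr j)
  invFun
    | none => .inl none
    | some (.inl i) => .inl (some i)
    | some (.inr j) => .inr j
  left_inv := by rintro ((_ | i) | j) <;> rfl
  right_inv := by rintro (_ | i | j) <;> rfl

/-- The exchange of the two distinguished points. -/
def optionSwap (I : Type) : Option (Option I) ≃ Option (Option I) where
  toFun
    | none => some none
    | some none => none
    | some (some i) => some (some i)
  invFun
    | none => some none
    | some none => none
    | some (some i) => some (some i)
  left_inv := by rintro (_ | _ | i) <;> rfl
  right_inv := by rintro (_ | _ | i) <;> rfl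

/-- The bijection `(I ⊔ K) ⊔ J ≃ (I ⊔ J) ⊔ K`. -/
def sumExchange (I J K : Type) : (I ⊕ K) ⊕ J ≃ (I ⊕ J) ⊕ K where
  toFun
    | .inl (.inl i) => .inl (.inl i)
    | .inl (.inr k) => .inr k
    | .inr j => .inl (.inr j)
  invFun
    | .inl (.inl i) => .inl (.inl i)
    | .inl (.inr j) => .inr j
    | .inr k => .inl (.inr k)
  left_inv := by rintro ((i | k) | j) <;> rfl
  right_inv := by rintro ((i | j) | k) <;> rfl

/-- The bijection from a one-point set to `Option Empty`. -/
def unitEquivOptionEmpty : Unit ≃ Option Empty where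
  toFun _ := none
  invFun _ := ()
  left_inv _ := rfl
  right_inv := by rintro (_ | ⟨⟨⟩⟩); rfl

/-- The bijection from `I ⊔ {∗}` to `Option I`. -/
def sumUnitEquivOption (I : Type) : I ⊕ Unit ≃ Option I where
  toFun
    | .inl i => some i
    | .inr _ => none
  invFun
    | none => .inr ()
    | some i => .inl i
  left_inv := by rintro (i | _) <;> rfl
  right_inv := by rintro (_ | i) <;> rfl

/-- A symmetric operad in `k`-vector spaces, in the coordinate-free form: inputs are labelled by
an arbitrary finite set `I` (the space `P(n)` is `obj (Fin n)`, and `map` on permutations of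
`Fin n` is the action of the symmetric group), and composition is given by the partial
compositions `p ∘ q`, where the operation `q` is inserted into one distinguished input of `p`. The
distinguished input is the element `none` of `Option I`; the other inputs are those in `I`. -/
structure SymmOperad (k : Type u) [Field k] where
  obj : (I : Type) → [Finite I] → Type u
  [addCommGroup : ∀ (I : Type) [Finite I], AddCommGroup (obj I)]
  [module : ∀ (I : Type) [Finite I], Module k (obj I)]
  /-- relabelling of inputs -/
  map : ∀ {I J : Type} [Finite I] [Finite J], (I ≃ J) → obj I →ₗ[k] obj J
  /-- the identity operation -/
  one : obj Unit
  /-- partial composition at the input `none` -/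
  comp : ∀ {I J : Type} [Finite I] [Finite J], obj (Option I) →ₗ[k] obj J →ₗ[k] obj (I ⊕ J)
  map_refl : ∀ {I : Type} [Finite I] (p : obj I), map (Equiv.refl I) p = p
  map_trans : ∀ {I J K : Type} [Finite I] [Finite J] [Finite K] (e : I ≃ J) (f : J ≃ K)
    (p : obj I), map (e.trans f) p = map f (map e p)
  comp_map : ∀ {I I' J J' : Type} [Finite I] [Finite I'] [Finite J] [Finite J']
    (e : I ≃ I') (f : J ≃ J') (p : obj (Option I)) (q : obj J),
    comp (map (Equiv.optionCongr e) p) (map f q) = map (Equiv.sumCongr e f) (comp p q)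
  /-- sequential associativity -/
  comp_assoc : ∀ {I J K : Type} [Finite I] [Finite J] [Finite K]
    (p : obj (Option I)) (q : obj (Option J)) (r : obj K),
    comp (map (optionSumRight I J) (comp p q)) r =
      map (Equiv.sumAssoc I J K).symm (comp p (comp q r))
  /-- parallel associativity -/
  comp_comm : ∀ {I J K : Type} [Finite I] [Finite J] [Finite K]
    (p : obj (Option (Option I))) (q : obj J) (r : obj K),
    comp (map (optionSumLeft I J) (comp p q)) r =
      map (sumExchange I J K)
        (comp (map (optionSumLeft I K) (comp (map (optionSwap I) p) r)) q)
  comp_one : ∀ {I : Type} [Finite I] (p : obj (Option I)),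
    map (sumUnitEquivOption I) (comp p one) = p
  one_comp : ∀ {I : Type} [Finite I] (p : obj I),
    map (Equiv.emptySum Empty I) (comp (map unitEquivOptionEmpty one) p) = p

attribute [instance] SymmOperad.addCommGroup SymmOperad.module

namespace SymmOperad

variable {k : Type u} [Field k]

/-- The Hadamard product `P ⊗ Q`: the spaces `P(I) ⊗ Q(I)` with componentwise relabelling and
composition. -/
noncomputable def hadamard (P Q : SymmOperad k) : SymmOperad k where
  obj I _ := TensorProduct k (P.obj I) (Q.obj I)
  map e := TensorProduct.map (P.map e) (Q.map e)
  one := TensorProduct.tmul k P.one Q.one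
  comp := TensorProduct.map₂ P.comp Q.comp
  map_refl p := by
    induction p using TensorProduct.induction_on with
    | zero => simp
    | tmul a b => simp [P.map_refl, Q.map_refl]
    | add x y hx hy => simp [hx, hy]
  map_trans e f p := by
    induction p using TensorProduct.induction_on with
    | zero => simp
    | tmul a b => simp [P.map_trans, Q.map_trans]
    | add x y hx hy => simp [hx, hy]
  comp_map e f p q := by
    induction p using TensorProduct.induction_on with
    | zero => simp
    | add x y hx hy => simp [hx, hy]
    | tmul a b =>
      induction q using TensorProduct.induction_on with
      | zero => simp
      | add x y hx hy => simp only [map_add, hx, hy]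
      | tmul c d => simp [P.comp_map, Q.comp_map]
  comp_assoc p q r := by
    induction p using TensorProduct.induction_on with
    | zero => simp
    | add x y hx hy => simp only [map_add, LinearMap.add_apply, hx, hy]
    | tmul a b =>
      induction q using TensorProduct.induction_on with
      | zero => simp
      | add x y hx hy => simp only [map_add, LinearMap.add_apply, hx, hy]
      | tmul c d =>
        induction r using TensorProduct.induction_on with
        | zero => simp
        | add x y hx hy => simp only [map_add, hx, hy]
        | tmul e f => simp [P.comp_assoc, Q.comp_assoc]
  comp_comm p q r := by
    induction p using TensorProduct.induction_on with
    | zero => simp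
    | add x y hx hy => simp only [map_add, LinearMap.add_apply, hx, hy]
    | tmul a b =>
      induction q using TensorProduct.induction_on with
      | zero => simp
      | add x y hx hy => simp only [map_add, LinearMap.add_apply, hx, hy]
      | tmul c d =>
        induction r using TensorProduct.induction_on with
        | zero => simp
        | add x y hx hy => simp only [map_add, LinearMap.add_apply, hx, hy]
        | tmul e f =>
          simp only [TensorProduct.map₂_apply_tmul, TensorProduct.map_tmul]
          rw [P.comp_comm, Q.comp_comm]
  comp_one p := by
    induction p using TensorProduct.induction_on with
    | zero => simp
    | add x y hx hy => simp only [map_add, LinearMap.add_apply, hx, hy]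
    | tmul a b => simp [P.comp_one, Q.comp_one]
  one_comp p := by
    induction p using TensorProduct.induction_on with
    | zero => simp
    | add x y hx hy => simp only [map_add, hx, hy]
    | tmul a b => simp [P.one_comp, Q.one_comp]

/-- A suboperad: a family of subspaces containing the identity and closed under relabelling and
composition. -/
structure Sub (P : SymmOperad k) where
  carrier : (I : Type) → [Finite I] → Submodule k (P.obj I)
  map_mem : ∀ {I J : Type} [Finite I] [Finite J] (e : I ≃ J) {p : P.obj I},
    p ∈ carrier I → P.map e p ∈ carrier J
  one_mem : P.one ∈ carrier Unit
  comp_mem : ∀ {I J : Type} [Finite I] [Finite J] {p : P.obj (Option I)} {q : P.obj J},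
    p ∈ carrier (Option I) → q ∈ carrier J → P.comp p q ∈ carrier (I ⊕ J)

/-- A suboperad as an operad. -/
def Sub.toOperad {P : SymmOperad k} (S : P.Sub) : SymmOperad k where
  obj I _ := S.carrier I
  map e := (P.map e).restrict fun _ hp => S.map_mem e hp
  one := ⟨P.one, S.one_mem⟩
  comp := LinearMap.mk₂ k (fun p q => ⟨P.comp p.1 q.1, S.comp_mem p.2 q.2⟩)
    (fun _ _ _ => Subtype.ext (by simp)) (fun _ _ _ => Subtype.ext (by simp))
    (fun _ _ _ => Subtype.ext (by simp)) (fun _ _ _ => Subtype.ext (by simp))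
  map_refl p := Subtype.ext (P.map_refl p.1)
  map_trans e f p := Subtype.ext (P.map_trans e f p.1)
  comp_map e f p q := Subtype.ext (P.comp_map e f p.1 q.1)
  comp_assoc p q r := Subtype.ext (P.comp_assoc p.1 q.1 r.1)
  comp_comm p q r := Subtype.ext (P.comp_comm p.1 q.1 r.1)
  comp_one p := Subtype.ext (P.comp_one p.1)
  one_comp p := Subtype.ext (P.one_comp p.1)

/-- The suboperad generated by the whole binary component `P(2)`: the smallest suboperad
containing all `P(I)` with `I` a two-element set. -/
def binaryPart (P : SymmOperad k) : P.Sub where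
  carrier I _ :=
    ⨅ (S : P.Sub) (_ : ∀ (J : Type) [Finite J], Nat.card J = 2 → S.carrier J = ⊤), S.carrier I
  map_mem e p hp := by
    simp only [Submodule.mem_iInf] at hp ⊢
    exact fun S hS => S.map_mem e (hp S hS)
  one_mem := by
    simp only [Submodule.mem_iInf]
    exact fun S _ => S.one_mem
  comp_mem hp hq := by
    simp only [Submodule.mem_iInf] at hp hq ⊢
    exact fun S hS => S.comp_mem (hp S hS) (hq S hS)

theorem mem_binaryPart (P : SymmOperad k) (I : Type) [Finite I] (hI : Nat.card I = 2)
    (p : P.obj I) : p ∈ P.binaryPart.carrier I := by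
  simp only [binaryPart, Submodule.mem_iInf]
  intro S hS
  rw [hS I hI]
  trivial

/-- The Manin white product: the suboperad of the Hadamard product `P ⊗ Q` generated by
`P(2) ⊗ Q(2)`. -/
noncomputable def whiteProduct (P Q : SymmOperad k) : SymmOperad k :=
  (hadamard P Q).binaryPart.toOperad

/-- The structure of an algebra over the operad `P` on a `k`-vector space `A`. -/
structure Alg (P : SymmOperad k) (A : Type v) [AddCommGroup A] [Module k A] where
  act : ∀ {I : Type} [Finite I], P.obj I →ₗ[k] MultilinearMap k (fun _ : I => A) A
  act_map : ∀ {I J : Type} [Finite I] [Finite J] (e : I ≃ J) (p : P.obj I) (a : J → A),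
    act (P.map e p) a = act p (fun i => a (e i))
  act_one : ∀ a : Unit → A, act P.one a = a ()
  act_comp : ∀ {I J : Type} [Finite I] [Finite J] (p : P.obj (Option I)) (q : P.obj J)
    (a : I ⊕ J → A), act (P.comp p q) a =
      act p (fun o => o.elim (act q fun j => a (.inr j)) fun i => a (.inl i))

end SymmOperad

/-! ### Multilinear varieties of algebras with one binary operation -/

/-- The variables occurring in a nonassociative word, with multiplicities. -/
def FreeMagma.leaves {X : Type} : FreeMagma X → Multiset X
  | .of x => {x}
  | .mul a b => a.leaves + b.leaves

/-- A nonassociative word is multilinear if each variable of `X` occurs in it exactly once. -/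
def FreeMagma.IsMultilinear {X : Type} (w : FreeMagma X) : Prop :=
  w.leaves.Nodup ∧ ∀ x, x ∈ w.leaves

/-- The span of the values of all multilinear words in the elements `g x`, `x ∈ X`, of a
nonassociative algebra. -/
def multilinearSpan (k : Type u) [Field k] {X : Type} {B : Type v} [NonUnitalNonAssocRing B]
    [Module k B] (g : X → B) : Submodule k B :=
  Submodule.span k {b | ∃ w : FreeMagma X, w.IsMultilinear ∧ FreeMagma.lift g w = b}

/-- A multilinear variety of `k`-algebras with one bilinear operation, given by a set of defining
identities, each of them multilinear in its variables `x₀, …, xₙ₋₁`. -/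
structure MultilinearVariety (k : Type u) [Field k] where
  rel : (n : ℕ) → Set (FreeNonUnitalNonAssocAlgebra k (Fin n))
  multilinear : ∀ (n : ℕ), ∀ f ∈ rel n, f ∈ multilinearSpan k (FreeNonUnitalNonAssocAlgebra.of k)

namespace MultilinearVariety

variable {k : Type u} [Field k] (V : MultilinearVariety k)

/-- The algebra `A` belongs to the variety. -/
def Mem (A : Type v) [NonUnitalNonAssocRing A] [Module k A] [IsScalarTower k A A]
    [SMulCommClass k A A] : Prop :=
  ∀ (n : ℕ), ∀ f ∈ V.rel n, ∀ a : Fin n → A, FreeNonUnitalNonAssocAlgebra.lift k a f = 0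

/-- The T-ideal of all identities in the variables `X` that hold on the variety. -/
def tIdeal (X : Type) : Submodule k (FreeNonUnitalNonAssocAlgebra k X) where
  carrier := {f | ∀ (A : Type u) [NonUnitalNonAssocRing A] [Module k A] [IsScalarTower k A A]
    [SMulCommClass k A A], V.Mem A → ∀ a : X → A, FreeNonUnitalNonAssocAlgebra.lift k a f = 0}
  zero_mem' := by intro A _ _ _ _ _ a; simp
  add_mem' := by
    intro f g hf hg A _ _ _ _ hA a
    rw [map_add, hf A hA a, hg A hA a, add_zero]
  smul_mem' := by
    intro c f hf A _ _ _ _ hA a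
    rw [map_smul, hf A hA a, smul_zero]

theorem tIdeal_mul_left {X : Type} (f : FreeNonUnitalNonAssocAlgebra k X)
    {g : FreeNonUnitalNonAssocAlgebra k X} (hg : g ∈ V.tIdeal X) : f * g ∈ V.tIdeal X := by
  intro A _ _ _ _ hA a
  rw [map_mul, hg A hA a, mul_zero]

theorem tIdeal_mul_right {X : Type} (f : FreeNonUnitalNonAssocAlgebra k X)
    {g : FreeNonUnitalNonAssocAlgebra k X} (hg : g ∈ V.tIdeal X) : g * f ∈ V.tIdeal X := by
  intro A _ _ _ _ hA a
  rw [map_mul, hg A hA a, zero_mul]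

/-- The free algebra `Var⟨X⟩` of the variety: the free nonassociative algebra modulo the T-ideal. -/
def Free (X : Type) : Type u := FreeNonUnitalNonAssocAlgebra k X ⧸ V.tIdeal X

namespace Free

variable {V} {X Y Z : Type}

noncomputable instance : AddCommGroup (V.Free X) :=
  inferInstanceAs (AddCommGroup (FreeNonUnitalNonAssocAlgebra k X ⧸ V.tIdeal X))

noncomputable instance : Module k (V.Free X) :=
  inferInstanceAs (Module k (FreeNonUnitalNonAssocAlgebra k X ⧸ V.tIdeal X))

/-- The quotient map. -/
noncomputable def mkₗ : FreeNonUnitalNonAssocAlgebra k X →ₗ[k] V.Free X := (V.tIdeal X).mkQ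

theorem mkₗ_surjective : Function.Surjective (mkₗ : _ →ₗ[k] V.Free X) :=
  (V.tIdeal X).mkQ_surjective

theorem mkₗ_eq_zero {f : FreeNonUnitalNonAssocAlgebra k X} :
    (mkₗ f : V.Free X) = 0 ↔ f ∈ V.tIdeal X :=
  Submodule.Quotient.mk_eq_zero _

theorem mkₗ_eq {f g : FreeNonUnitalNonAssocAlgebra k X} :
    (mkₗ f : V.Free X) = mkₗ g ↔ f - g ∈ V.tIdeal X :=
  Submodule.Quotient.eq _

noncomputable instance : Mul (V.Free X) where
  mul := Quotient.map₂ (· * ·) (by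
    intro a b hab c d hcd
    have h1 : a - b ∈ V.tIdeal X := (Submodule.quotientRel_def _).1 hab
    have h2 : c - d ∈ V.tIdeal X := (Submodule.quotientRel_def _).1 hcd
    refine (Submodule.quotientRel_def _).2 ?_
    have : a * c - b * d = a * (c - d) + (a - b) * d := by
      rw [mul_sub, sub_mul]; abel
    rw [this]
    exact add_mem (V.tIdeal_mul_left _ h2) (V.tIdeal_mul_right _ h1))

theorem mkₗ_mul (f g : FreeNonUnitalNonAssocAlgebra k X) :
    (mkₗ (f * g) : V.Free X) = mkₗ f * mkₗ g := rfl

noncomputable instance : NonUnitalNonAssocRing (V.Free X) where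
  left_distrib a b c := by
    obtain ⟨a, rfl⟩ := mkₗ_surjective a
    obtain ⟨b, rfl⟩ := mkₗ_surjective b
    obtain ⟨c, rfl⟩ := mkₗ_surjective c
    simp only [← map_add, ← mkₗ_mul, mul_add]
  right_distrib a b c := by
    obtain ⟨a, rfl⟩ := mkₗ_surjective a
    obtain ⟨b, rfl⟩ := mkₗ_surjective b
    obtain ⟨c, rfl⟩ := mkₗ_surjective c
    simp only [← map_add, ← mkₗ_mul, add_mul]
  zero_mul a := by
    obtain ⟨a, rfl⟩ := mkₗ_surjective a
    rw [← map_zero (mkₗ (V := V)), ← mkₗ_mul, zero_mul]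
  mul_zero a := by
    obtain ⟨a, rfl⟩ := mkₗ_surjective a
    rw [← map_zero (mkₗ (V := V)), ← mkₗ_mul, mul_zero]

instance : IsScalarTower k (V.Free X) (V.Free X) where
  smul_assoc c a b := by
    obtain ⟨a, rfl⟩ := mkₗ_surjective a
    obtain ⟨b, rfl⟩ := mkₗ_surjective b
    simp only [smul_eq_mul, ← map_smul, ← mkₗ_mul, smul_mul_assoc]

instance : SMulCommClass k (V.Free X) (V.Free X) where
  smul_comm c a b := by
    obtain ⟨a, rfl⟩ := mkₗ_surjective a
    obtain ⟨b, rfl⟩ := mkₗ_surjective b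
    simp only [smul_eq_mul, ← map_smul, ← mkₗ_mul, mul_smul_comm]

/-- The quotient map as a homomorphism of algebras. -/
noncomputable def mkHom : FreeNonUnitalNonAssocAlgebra k X →ₙₐ[k] V.Free X :=
  { (mkₗ : _ →ₗ[k] V.Free X) with
    map_zero' := map_zero mkₗ
    map_mul' := mkₗ_mul }

theorem mkHom_apply (f : FreeNonUnitalNonAssocAlgebra k X) : (mkHom f : V.Free X) = mkₗ f := rfl

theorem mkHom_surjective : Function.Surjective (mkHom : _ →ₙₐ[k] V.Free X) := mkₗ_surjective

/-- The free generators. -/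
noncomputable def of (x : X) : V.Free X := mkHom (FreeNonUnitalNonAssocAlgebra.of k x)

theorem hom_ext {B : Type v} [NonUnitalNonAssocRing B] [Module k B]
    [IsScalarTower k B B] [SMulCommClass k B B] {F G : V.Free X →ₙₐ[k] B}
    (h : ∀ x, F (of x) = G (of x)) : F = G := by
  have : F.comp mkHom = G.comp mkHom := FreeNonUnitalNonAssocAlgebra.hom_ext k h
  ext a
  obtain ⟨a, rfl⟩ := mkHom_surjective a
  exact DFunLike.congr_fun this a

/-- The free algebra belongs to the variety. -/
theorem mem : V.Mem (V.Free X) := by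
  intro n f hf a
  choose b hb using fun i => mkHom_surjective (V := V) (a i)
  have h1 : FreeNonUnitalNonAssocAlgebra.lift k a =
      mkHom.comp (FreeNonUnitalNonAssocAlgebra.lift k b) := by
    apply FreeNonUnitalNonAssocAlgebra.hom_ext
    intro x
    simp [hb]
  rw [h1, NonUnitalAlgHom.comp_apply, mkHom_apply, mkₗ_eq_zero]
  intro A _ _ _ _ hA c
  have h2 : (FreeNonUnitalNonAssocAlgebra.lift k c).comp (FreeNonUnitalNonAssocAlgebra.lift k b) =
      FreeNonUnitalNonAssocAlgebra.lift k
        (fun i => FreeNonUnitalNonAssocAlgebra.lift k c (b i)) := by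
    apply FreeNonUnitalNonAssocAlgebra.hom_ext
    intro x
    simp
  rw [← NonUnitalAlgHom.comp_apply, h2]
  exact hA n f hf _

/-- The substitution of elements `φ x` of `Var⟨Y⟩` for the generators `x` of `Var⟨X⟩`. -/
noncomputable def subst (φ : X → V.Free Y) : V.Free X →ₙₐ[k] V.Free Y :=
  { (V.tIdeal X).liftQ (FreeNonUnitalNonAssocAlgebra.lift k φ : _ →ₗ[k] V.Free Y)
      (fun _ hf => LinearMap.mem_ker.2 (hf _ mem φ)) with
    map_zero' := map_zero ((V.tIdeal X).liftQ _ _)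
    map_mul' := fun a b => by
      obtain ⟨a, rfl⟩ := mkₗ_surjective a
      obtain ⟨b, rfl⟩ := mkₗ_surjective b
      exact map_mul (FreeNonUnitalNonAssocAlgebra.lift k φ) a b }

@[simp] theorem subst_of (φ : X → V.Free Y) (x : X) : subst φ (of x) = φ x :=
  FreeNonUnitalNonAssocAlgebra.lift_of_apply k φ x

theorem subst_subst (φ : X → V.Free Y) (ψ : Y → V.Free Z) (a : V.Free X) :
    subst ψ (subst φ a) = subst (fun x => subst ψ (φ x)) a := by
  have : (subst ψ).comp (subst φ) = subst (fun x => subst ψ (φ x)) := hom_ext (by simp)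
  exact DFunLike.congr_fun this a

theorem subst_of_eq (a : V.Free X) : subst of a = a := by
  have : subst (of : X → V.Free X) = NonUnitalAlgHom.id k _ := hom_ext (by simp)
  exact DFunLike.congr_fun this a

theorem subst_lift (φ : X → V.Free Y) (w : FreeMagma X) :
    subst φ (FreeMagma.lift of w) = FreeMagma.lift φ w := by
  induction w with
  | ih1 x => exact subst_of φ x
  | ih2 a b ha hb => rw [map_mul, map_mul, map_mul, ha, hb]

end Free

end MultilinearVariety

section Words

variable {k : Type u} [Field k] {B : Type v} [NonUnitalNonAssocRing B] [Module k B]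
  [IsScalarTower k B B] [SMulCommClass k B B] {X Y : Type}

theorem FreeMagma.leaves_mul (a b : FreeMagma X) : (a * b).leaves = a.leaves + b.leaves := rfl

/-- The span of the values of all words with a given multiset of variables. -/
def wordSpan (k : Type u) [Field k] {X : Type} {B : Type v} [NonUnitalNonAssocRing B]
    [Module k B] (g : X → B) (m : Multiset X) : Submodule k B :=
  Submodule.span k {b | ∃ w : FreeMagma X, w.leaves = m ∧ FreeMagma.lift g w = b}

theorem wordSpan_mul (g : X → B) {m n : Multiset X} {a b : B}
    (ha : a ∈ wordSpan k g m) (hb : b ∈ wordSpan k g n) : a * b ∈ wordSpan k g (m + n) := by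
  induction ha using Submodule.span_induction with
  | zero => rw [zero_mul]; exact zero_mem _
  | add x y _ _ hx hy => rw [add_mul]; exact add_mem hx hy
  | smul c x _ hx => rw [smul_mul_assoc]; exact Submodule.smul_mem _ _ hx
  | mem x hx =>
    obtain ⟨w, hw, rfl⟩ := hx
    induction hb using Submodule.span_induction with
    | zero => rw [mul_zero]; exact zero_mem _
    | add x y _ _ hx hy => rw [mul_add]; exact add_mem hx hy
    | smul c x _ hx => rw [mul_smul_comm]; exact Submodule.smul_mem _ _ hx
    | mem y hy =>
      obtain ⟨w', hw', rfl⟩ := hy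
      refine Submodule.subset_span ⟨w * w', ?_, map_mul _ _ _⟩
      rw [FreeMagma.leaves_mul, hw, hw']

theorem lift_mem_wordSpan (g : Y → B) (φ : X → B) (m : X → Multiset Y)
    (h : ∀ x, φ x ∈ wordSpan k g (m x)) (w : FreeMagma X) :
    FreeMagma.lift φ w ∈ wordSpan k g (w.leaves.bind m) := by
  induction w with
  | ih1 x =>
    have : (FreeMagma.of x).leaves.bind m = m x := Multiset.singleton_bind x m
    rw [this]
    exact h x
  | ih2 a b ha hb =>
    rw [map_mul, FreeMagma.leaves_mul, Multiset.add_bind]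
    exact wordSpan_mul g ha hb

theorem multilinearSpan_eq_wordSpan {k : Type u} [Field k] {B : Type v} [NonUnitalNonAssocRing B]
    [Module k B] {X : Type} (g : X → B) {m : Multiset X} (hm : m.Nodup)
    (hm' : ∀ x, x ∈ m) : multilinearSpan k g = wordSpan k g m := by
  unfold multilinearSpan wordSpan
  congr 1
  ext b
  constructor
  · rintro ⟨w, hw, rfl⟩
    exact ⟨w, (Multiset.Nodup.ext hw.1 hm).2 fun x => by simp [hw.2 x, hm' x], rfl⟩
  · rintro ⟨w, rfl, rfl⟩
    exact ⟨w, ⟨hm, hm'⟩, rfl⟩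

/-- A finite set as a multiset. -/
noncomputable def univMultiset (X : Type) [Finite X] : Multiset X :=
  (@Finset.univ X (Fintype.ofFinite X)).val

theorem nodup_univMultiset (X : Type) [Finite X] : (univMultiset X).Nodup := Finset.nodup _

theorem mem_univMultiset {X : Type} [Finite X] (x : X) : x ∈ univMultiset X :=
  @Finset.mem_univ X (Fintype.ofFinite X) x

/-- The value of a word in which the variable `none` occurs exactly once depends linearly on the
value of this variable. -/
theorem lift_isLinearMap (r : X → B) (w : FreeMagma (Option X)) :
    (none ∉ w.leaves → ∀ q q' : B, FreeMagma.lift (fun o => Option.elim o q r) w =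
      FreeMagma.lift (fun o => Option.elim o q' r) w) ∧
    (none ∈ w.leaves → w.leaves.Nodup →
      IsLinearMap k (fun q : B => FreeMagma.lift (fun o => Option.elim o q r) w)) := by
  induction w with
  | ih1 x =>
    constructor
    · intro h q q'
      rcases x with _ | x
      · exact absurd (Multiset.mem_singleton_self _) h
      · rfl
    · intro h _
      rcases x with _ | x
      · exact ⟨fun _ _ => rfl, fun _ _ => rfl⟩
      · exact absurd (Multiset.mem_singleton.1 h) (by simp)
  | ih2 a b ha hb =>
    simp only [FreeMagma.leaves_mul, Multiset.mem_add, not_or, map_mul]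
    constructor
    · rintro ⟨h1, h2⟩ q q'
      rw [ha.1 h1 q q', hb.1 h2 q q']
    · intro h hn
      obtain ⟨hna, hnb, hd⟩ := Multiset.nodup_add.1 hn
      rcases h with h | h
      · have h' : none ∉ b.leaves := Multiset.disjoint_left.1 hd h
        have hl := ha.2 h hna
        refine ⟨fun x y => ?_, fun c x => ?_⟩
        · rw [hl.map_add, add_mul, hb.1 h' (x + y) x, hb.1 h' y x]
        · rw [hl.map_smul, smul_mul_assoc, hb.1 h' (c • x) x]
      · have h' : none ∉ a.leaves := fun ha' => Multiset.disjoint_left.1 hd ha' h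
        have hl := hb.2 h hnb
        refine ⟨fun x y => ?_, fun c x => ?_⟩
        · rw [hl.map_add, mul_add, ha.1 h' (x + y) x, ha.1 h' y x]
        · rw [hl.map_smul, mul_smul_comm, ha.1 h' (c • x) x]

end Words

namespace MultilinearVariety

variable {k : Type u} [Field k] {V : MultilinearVariety k}

theorem subst_mem {X Y : Type} [Finite X] [Finite Y] (φ : X → V.Free Y) (m : X → Multiset Y)
    (h : ∀ x, φ x ∈ wordSpan k Free.of (m x))
    (hn : ((univMultiset X).bind m).Nodup) (hm : ∀ y, ∃ x, y ∈ m x)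
    {p : V.Free X} (hp : p ∈ multilinearSpan k (Free.of : X → V.Free X)) :
    Free.subst φ p ∈ multilinearSpan k (Free.of : Y → V.Free Y) := by
  rw [multilinearSpan_eq_wordSpan _ hn fun y => by
    obtain ⟨x, hx⟩ := hm y
    exact Multiset.mem_bind.2 ⟨x, mem_univMultiset x, hx⟩]
  rw [multilinearSpan_eq_wordSpan _ (nodup_univMultiset X) mem_univMultiset] at hp
  induction hp using Submodule.span_induction with
  | zero => rw [map_zero]; exact zero_mem _
  | add x y _ _ hx hy => rw [map_add]; exact add_mem hx hy
  | smul c x _ hx => rw [map_smul]; exact Submodule.smul_mem _ _ hx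
  | mem x hx =>
    obtain ⟨w, hw, rfl⟩ := hx
    rw [Free.subst_lift, ← hw]
    exact lift_mem_wordSpan _ _ m h w

theorem of_mem_wordSpan {X : Type} (x : X) :
    (Free.of x : V.Free X) ∈ wordSpan k Free.of {x} :=
  Submodule.subset_span ⟨FreeMagma.of x, rfl, rfl⟩

theorem subst_equiv_mem {X Y : Type} [Finite X] [Finite Y] (e : X ≃ Y)
    {p : V.Free X} (hp : p ∈ multilinearSpan k (Free.of : X → V.Free X)) :
    Free.subst (fun x => Free.of (e x)) p ∈ multilinearSpan k (Free.of : Y → V.Free Y) := by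
  refine subst_mem _ (fun x => {e x}) (fun x => of_mem_wordSpan _) ?_
    (fun y => ⟨e.symm y, by simp⟩) hp
  rw [Multiset.bind_singleton]
  exact (nodup_univMultiset X).map e.injective

/-- The images of the generators under the insertion of `q` into the variable `none`. -/
noncomputable def insertion {I J : Type} (q : V.Free J) (o : Option I) : V.Free (I ⊕ J) :=
  o.elim (Free.subst (fun j => Free.of (.inr j)) q) fun i => Free.of (.inl i)

theorem subst_inr_mem {I J : Type} [Finite J]
    {q : V.Free J} (hq : q ∈ multilinearSpan k (Free.of : J → V.Free J)) :
    Free.subst (fun j => (Free.of (.inr j) : V.Free (I ⊕ J))) q ∈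
      wordSpan k (Free.of : I ⊕ J → V.Free (I ⊕ J)) ((univMultiset J).map Sum.inr) := by
  rw [multilinearSpan_eq_wordSpan _ (nodup_univMultiset J) mem_univMultiset] at hq
  induction hq using Submodule.span_induction with
  | zero => rw [map_zero]; exact zero_mem _
  | add x y _ _ hx hy => rw [map_add]; exact add_mem hx hy
  | smul c x _ hx => rw [map_smul]; exact Submodule.smul_mem _ _ hx
  | mem x hx =>
    obtain ⟨w, hw, rfl⟩ := hx
    rw [Free.subst_lift, ← hw, ← Multiset.bind_singleton]
    exact lift_mem_wordSpan _ _ (fun j => {Sum.inr j}) (fun j => of_mem_wordSpan _) w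

theorem subst_insertion_mem {I J : Type} [Finite I] [Finite J]
    {p : V.Free (Option I)} (hp : p ∈ multilinearSpan k (Free.of : Option I → V.Free (Option I)))
    {q : V.Free J} (hq : q ∈ multilinearSpan k (Free.of : J → V.Free J)) :
    Free.subst (insertion q) p ∈ multilinearSpan k (Free.of : I ⊕ J → V.Free (I ⊕ J)) := by
  refine subst_mem _ (fun o => Option.elim o ((univMultiset J).map (Sum.inr : J → I ⊕ J))
    fun i => {Sum.inl i}) ?_ ?_ ?_ hp
  · rintro (_ | i)
    · exact subst_inr_mem hq
    · exact of_mem_wordSpan _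
  · rw [Multiset.nodup_bind]
    constructor
    · rintro (_ | i) -
      · exact (nodup_univMultiset J).map Sum.inr_injective
      · exact Multiset.nodup_singleton _
    · refine (nodup_univMultiset (Option I)).pairwise ?_
      rintro (_ | i) - (_ | i') - hne <;> unfold Function.onFun
      · exact absurd rfl hne
      · simp [Multiset.disjoint_left]
      · simp [Multiset.disjoint_left]
      · simpa [Multiset.disjoint_left, eq_comm] using hne
  · rintro (i | j)
    · exact ⟨some i, by simp⟩
    · exact ⟨none, by simp [mem_univMultiset]⟩

theorem subst_insertion_isLinearMap {I J : Type}
    {p : V.Free (Option I)} (hp : p ∈ multilinearSpan k (Free.of : Option I → V.Free (Option I))) :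
    IsLinearMap k (fun q : V.Free J => Free.subst (insertion q) p) := by
  induction hp using Submodule.span_induction with
  | zero => exact ⟨by simp, by simp⟩
  | add x y _ _ hx hy =>
    refine ⟨fun a b => ?_, fun c a => ?_⟩
    · simp only [map_add, hx.map_add, hy.map_add]; abel
    · simp only [map_add, hx.map_smul, hy.map_smul, smul_add]
  | smul d x _ hx =>
    refine ⟨fun a b => ?_, fun c a => ?_⟩
    · simp only [map_smul, hx.map_add, smul_add]
    · simp only [map_smul, hx.map_smul, smul_comm c d]
  | mem x hx =>
    obtain ⟨w, hw, rfl⟩ := hx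
    have h := (lift_isLinearMap (k := k) (fun i : I => (Free.of (.inl i) : V.Free (I ⊕ J))) w).2
      (hw.2 none) hw.1
    simp only [Free.subst_lift]
    refine ⟨fun a b => ?_, fun c a => ?_⟩
    · have := h.map_add (Free.subst (fun j => Free.of (.inr j)) a)
        (Free.subst (fun j => Free.of (.inr j)) b)
      rw [← map_add] at this
      exact this
    · have := h.map_smul c (Free.subst (fun j => Free.of (.inr j)) a)
      rw [← map_smul] at this
      exact this

variable (V)

/-- The operad of a multilinear variety. Its component at `I` is the multilinear part of the free
algebra `Var⟨I⟩`, that is, the space of multilinear nonassociative polynomials in the variables `I`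
modulo the identities of the variety; composition is the substitution of polynomials. -/
noncomputable def operad : SymmOperad k where
  obj I _ := multilinearSpan k (Free.of : I → V.Free I)
  map e := (Free.subst (V := V) (fun x => Free.of (e x)) : _ →ₗ[k] _).restrict
    fun _ hp => subst_equiv_mem e hp
  one := ⟨Free.of (), Submodule.subset_span
    ⟨FreeMagma.of (), ⟨Multiset.nodup_singleton _, fun _ => Multiset.mem_singleton_self _⟩, rfl⟩⟩
  comp := LinearMap.mk₂ k
    (fun p q => ⟨Free.subst (insertion q.1) p.1, subst_insertion_mem p.2 q.2⟩)
    (fun _ _ _ => Subtype.ext (map_add _ _ _)) (fun _ _ _ => Subtype.ext (map_smul _ _ _))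
    (fun p _ _ => Subtype.ext ((subst_insertion_isLinearMap p.2).map_add _ _))
    (fun _ p _ => Subtype.ext ((subst_insertion_isLinearMap p.2).map_smul _ _))
  map_refl p := Subtype.ext (Free.subst_of_eq p.1)
  map_trans e f p := Subtype.ext (by
    change Free.subst _ p.1 = Free.subst _ (Free.subst _ p.1)
    rw [Free.subst_subst]
    simp)
  comp_map e f p q := Subtype.ext (by
    change Free.subst (insertion (Free.subst _ q.1)) (Free.subst _ p.1) =
      Free.subst _ (Free.subst (insertion q.1) p.1)
    rw [Free.subst_subst, Free.subst_subst]
    congr 2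
    funext o
    rcases o with _ | i <;> simp [insertion, Free.subst_subst])
  comp_assoc p q r := Subtype.ext (by
    change Free.subst (insertion r.1) (Free.subst _ (Free.subst (insertion q.1) p.1)) =
      Free.subst _ (Free.subst (insertion (Free.subst (insertion r.1) q.1)) p.1)
    simp only [Free.subst_subst]
    congr 2
    funext o
    rcases o with _ | i
    · simp only [insertion, Option.elim, Free.subst_subst, Free.subst_of]
      congr 2
      funext o
      rcases o with _ | j <;>
        simp [optionSumRight, Free.subst_subst]
    · simp [insertion, optionSumRight])
  comp_comm p q r := Subtype.ext (by
    change Free.subst (insertion r.1) (Free.subst _ (Free.subst (insertion q.1) p.1)) =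
      Free.subst _ (Free.subst (insertion q.1) (Free.subst _ (Free.subst (insertion r.1)
        (Free.subst _ p.1))))
    simp only [Free.subst_subst]
    congr 2
    funext o
    rcases o with _ | _ | i <;>
      simp [insertion, optionSumLeft, optionSwap, sumExchange, Free.subst_subst])
  comp_one p := Subtype.ext (by
    change Free.subst _ (Free.subst (insertion (Free.of ())) p.1) = p.1
    rw [Free.subst_subst]
    conv_rhs => rw [← Free.subst_of_eq p.1]
    congr 2
    funext o
    rcases o with _ | i <;> simp [insertion, sumUnitEquivOption])
  one_comp p := Subtype.ext (by
    change Free.subst _ (Free.subst (insertion p.1) (Free.subst _ (Free.of ()))) = p.1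
    conv_rhs => rw [← Free.subst_of_eq p.1]
    simp [insertion, unitEquivOptionEmpty, Free.subst_subst])

/-- The operation `x₁x₂ ∈ Var(2)`. -/
noncomputable def mul₁₂ : V.operad.obj (Fin 2) :=
  ⟨Free.of 0 * Free.of 1, Submodule.subset_span
    ⟨FreeMagma.of 0 * FreeMagma.of 1,
      ⟨by simp [FreeMagma.leaves],
        by simp [FreeMagma.leaves, Fin.forall_fin_two]⟩, rfl⟩⟩

/-- The operation `x₂x₁ ∈ Var(2)`. -/
noncomputable def mul₂₁ : V.operad.obj (Fin 2) :=
  ⟨Free.of 1 * Free.of 0, Submodule.subset_span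
    ⟨FreeMagma.of 1 * FreeMagma.of 0,
      ⟨by simp [FreeMagma.leaves],
        by simp [FreeMagma.leaves, Fin.forall_fin_two]⟩, rfl⟩⟩

end MultilinearVariety

section Novikov

open FreeNonUnitalNonAssocAlgebra in
/-- The variety of Novikov algebras, defined by the left symmetry
`(a ∘ b) ∘ c - a ∘ (b ∘ c) = (b ∘ a) ∘ c - b ∘ (a ∘ c)` and the right commutativity
`(a ∘ b) ∘ c = (a ∘ c) ∘ b`. -/
noncomputable def novikov (k : Type u) [Field k] : MultilinearVariety k where
  rel n := {f | ∃ h : n = 3,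
    let a := of k (Fin.cast h.symm 0)
    let b := of k (Fin.cast h.symm 1)
    let c := of k (Fin.cast h.symm 2)
    f = ((a * b) * c - a * (b * c)) - ((b * a) * c - b * (a * c)) ∨
    f = (a * b) * c - (a * c) * b}
  multilinear := by
    rintro n f ⟨rfl, hf⟩
    have hl : ∀ i j l : Fin 3, [i, j, l].Nodup →
        (of k i * of k j) * of k l ∈ multilinearSpan k (of k (X := Fin 3)) := fun i j l h =>
      Submodule.subset_span ⟨(FreeMagma.of i * FreeMagma.of j) * FreeMagma.of l,
        by
          have e : ((FreeMagma.of i * FreeMagma.of j) * FreeMagma.of l).leaves =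
            (([i, j, l] : List (Fin 3)) : Multiset (Fin 3)) := rfl
          refine ⟨by rw [e]; exact h, ?_⟩
          rw [e]
          revert i j l
          decide, rfl⟩
    have hr : ∀ i j l : Fin 3, [i, j, l].Nodup →
        of k i * (of k j * of k l) ∈ multilinearSpan k (of k (X := Fin 3)) := fun i j l h =>
      Submodule.subset_span ⟨FreeMagma.of i * (FreeMagma.of j * FreeMagma.of l),
        by
          have e : (FreeMagma.of i * (FreeMagma.of j * FreeMagma.of l)).leaves =
            (([i, j, l] : List (Fin 3)) : Multiset (Fin 3)) := rfl
          refine ⟨by rw [e]; exact h, ?_⟩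
          rw [e]
          revert i j l
          decide, rfl⟩
    rcases hf with rfl | rfl
    · exact sub_mem (sub_mem (hl 0 1 2 (by decide)) (hr 0 1 2 (by decide)))
        (sub_mem (hl 1 0 2 (by decide)) (hr 1 0 2 (by decide)))
    · exact sub_mem (hl 0 1 2 (by decide)) (hl 0 2 1 (by decide))

end Novikov

/-! ### Polynomials in the two operations `≺` and `≻` -/

/-- Nonassociative words in the variables `X` and two binary operations `≺`, `≻`. -/
inductive BiWord (X : Type) : Type
  | var : X → BiWord X
  | prec : BiWord X → BiWord X → BiWord X
  | succ : BiWord X → BiWord X → BiWord X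

namespace BiWord

variable {X : Type}

/-- The variables occurring in a word, with multiplicities. -/
def leaves : BiWord X → Multiset X
  | var x => {x}
  | prec a b => a.leaves + b.leaves
  | succ a b => a.leaves + b.leaves

/-- Each variable of `X` occurs in the word exactly once. -/
def IsMultilinear (w : BiWord X) : Prop := w.leaves.Nodup ∧ ∀ x, x ∈ w.leaves

/-- The value of a word in a set with two binary operations. -/
def eval {A : Type v} (p s : A → A → A) (a : X → A) : BiWord X → A
  | var x => a x
  | prec u v => p (u.eval p s a) (v.eval p s a)
  | succ u v => s (u.eval p s a) (v.eval p s a)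

end BiWord

/-- Nonassociative polynomials over `k` in the variables `X` and two operations `≺`, `≻`. -/
abbrev BiPoly (k : Type u) [Field k] (X : Type) : Type u := BiWord X →₀ k

namespace BiPoly

variable {k : Type u} [Field k] {X : Type}

/-- A multilinear polynomial in the variables `X`. -/
def IsMultilinear (f : BiPoly k X) : Prop := ∀ w ∈ f.support, w.IsMultilinear

/-- The value of a polynomial in a vector space with operations `p` (for `≺`) and `s`
(for `≻`). -/
noncomputable def eval {A : Type v} [AddCommGroup A] [Module k A] (p s : A → A → A) (a : X → A)
    (f : BiPoly k X) : A :=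
  f.sum fun w c => c • w.eval p s a

/-- The polynomial `f` is a derived identity of the variety `V`: for every `A ∈ V` and every
derivation `d` of `A`, the identity `f = 0` holds on `A^{(d)}`, that is, on the space `A` with the
operations `a ≺ b = a d(b)` and `a ≻ b = d(a) b`. -/
def IsDerivedIdentity (V : MultilinearVariety k) (f : BiPoly k X) : Prop :=
  ∀ (A : Type u) [NonUnitalNonAssocRing A] [Module k A] [IsScalarTower k A A]
    [SMulCommClass k A A], V.Mem A → ∀ d : A →ₗ[k] A,
    (∀ a b : A, d (a * b) = d a * b + a * d b) →
    ∀ x : X → A, f.eval (fun a b => a * d b) (fun a b => d a * b) x = 0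

end BiPoly

/-! ### The white product with the Novikov operad -/

namespace MultilinearVariety

variable {k : Type u} [Field k] (V : MultilinearVariety k)

/-- The operad `Var ∘ Nov`. -/
noncomputable def whiteNov : SymmOperad k := SymmOperad.whiteProduct V.operad (novikov k).operad

/-- The operation `x₁ ≺ x₂ = x₁x₂ ⊗ (x₁ ∘ x₂)` in `(Var ∘ Nov)(2)`. -/
noncomputable def precOp : V.whiteNov.obj (Fin 2) :=
  ⟨TensorProduct.tmul k V.mul₁₂ (novikov k).mul₁₂,
    SymmOperad.mem_binaryPart (SymmOperad.hadamard _ _) (Fin 2) (by simp) _⟩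

/-- The operation `x₁ ≻ x₂ = x₁x₂ ⊗ (x₂ ∘ x₁)` in `(Var ∘ Nov)(2)`. -/
noncomputable def succOp : V.whiteNov.obj (Fin 2) :=
  ⟨TensorProduct.tmul k V.mul₁₂ (novikov k).mul₂₁,
    SymmOperad.mem_binaryPart (SymmOperad.hadamard _ _) (Fin 2) (by simp) _⟩

/-- The identity `f = 0` holds on the `(Var ∘ Nov)`-algebra `A`. -/
def HoldsOnWhite {X : Type} (f : BiPoly k X) {A : Type v} [AddCommGroup A] [Module k A]
    (α : V.whiteNov.Alg A) : Prop :=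
  ∀ x : X → A, f.eval (fun a b => α.act V.precOp ![a, b]) (fun a b => α.act V.succOp ![a, b]) x = 0

end MultilinearVariety

/-! ### Novikov rings -/

/-! Let `A` be the free `Var`-algebra on `X` and `C` the differential polynomial algebra with
variables `(x, j)`, the `j`-th derivatives of `x`. Since the identities of `Var` are multilinear and
`C` is commutative, `A ⊗ C` lies in `Var`, and `id ⊗ diff` is a derivation of it. Evaluating a
derived identity at the elements `x ⊗ (x, 0)` sends a word `w` to `varWord w ⊗ diffWord (novWord
w)`, where `diffWord` interprets the Novikov product as `u ∘ v = u v'`. Hence the combination of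
these tensors vanishes. The remaining point is to replace `diffWord (novWord w)` by the word
`novWord w` itself in the free Novikov algebra. The resulting relation lives in `Var(n) ⊗ Nov(n)`,
because tensoring subspaces over a field is injective, so it is a relation between operations of
`Var ∘ Nov` and holds on every algebra over that operad.

The replacement needs a linear map from differential polynomials to a Novikov algebra `N` that takes
`diffWord w` to the value of `w` (`evalPair_diffWord`). It is built from operators on `N`. In the
model `a ∘ b = a b'`, right multiplication by `b` is multiplication by `b'`, and right
multiplications commute. A "symmetric family of degree m" imitates the operator of multiplication by
`a₁ ⋯ aₘ φ`, with `a₁, …, aₘ` as the entries of the list. Its axioms say that the entries may be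
permuted, that right multiplications can be pulled out of an entry, and that an entry can be
exchanged with the argument of the operator. In the model, multiplication by `a u₁ ⋯ uₘ φ'` is the
commutator `[L_a, F(u)]` minus the terms in which some `uᵢ` is replaced by `a ∘ uᵢ`; this is
`familyDeriv`. It preserves the axioms exactly because of left symmetry and right commutativity
(`IsSymmFamily.familyDeriv`, `ad_exchange`). Iterating it from right multiplication by `b` gives
`symbol b j`, the family of `b^(j+1)`.

A differential monomial of weight `-1` has exactly one more factor of order zero than the total
degree of its symbols. Its value is the product family applied to all but one of the order-zero
factors, and then to the last one; symmetry and exchange make the choice immaterial. The assignment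
is multiplicative on formal pairs (family, multiset of arguments), while sums of families are only
recognised after evaluation. The identity `evalPair (p q') = evalPair p * evalPair q` in weight `-1`
(`evalPair_mul_diff`) then yields the recovery of words by induction. No division occurs, so the
characteristic plays no role. -/

/-- A (nonunital, nonassociative) ring satisfying the Novikov identities. -/
class IsNovikov (N : Type*) [NonUnitalNonAssocRing N] : Prop where
  left_symm : ∀ a b c : N, (a * b) * c - a * (b * c) = (b * a) * c - b * (a * c)
  right_comm : ∀ a b c : N, (a * b) * c = (a * c) * b

namespace IsNovikov

variable (N : Type*) [NonUnitalNonAssocRing N]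

/-- The ring of additive operators generated by the right multiplications. -/
def rightOps : Subring (AddMonoid.End N) :=
  Subring.closure (Set.range fun b : N => (AddMonoidHom.mulRight b : AddMonoid.End N))

variable {N}

/-- The operator of right multiplication. -/
def rmul (b : N) : AddMonoid.End N := AddMonoidHom.mulRight b

/-- The operator of left multiplication. -/
def lmul (a : N) : AddMonoid.End N := AddMonoidHom.mulLeft a

@[simp] theorem rmul_apply (a b : N) : rmul b a = a * b := rfl

theorem rmul_mem (b : N) : rmul b ∈ rightOps N := Subring.subset_closure ⟨b, rfl⟩

@[elab_as_elim]
theorem rightOps_induction {p : ∀ r : AddMonoid.End N, r ∈ rightOps N → Prop}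
    {r : AddMonoid.End N} (hr : r ∈ rightOps N) (one : p 1 (one_mem _)) (zero : p 0 (zero_mem _))
    (rmul : ∀ b, p (rmul b) (rmul_mem b))
    (add : ∀ r hr s hs, p r hr → p s hs → p (r + s) (add_mem hr hs))
    (neg : ∀ r hr, p r hr → p (-r) (neg_mem hr))
    (mul : ∀ r hr s hs, p r hr → p s hs → p (r * s) (mul_mem hr hs)) : p r hr := by
  induction hr using Subring.closure_induction with
  | mem x hx => obtain ⟨b, rfl⟩ := hx; exact rmul b
  | zero => exact zero
  | one => exact one
  | add x y hx hy h h' => exact add x hx y hy h h'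
  | neg x hx h => exact neg x hx h
  | mul x y hx hy h h' => exact mul x hx y hy h h'

theorem end_mul_apply (r s : AddMonoid.End N) (a : N) : (r * s) a = r (s a) := rfl

theorem end_add_apply (r s : AddMonoid.End N) (a : N) : (r + s) a = r a + s a := rfl

theorem end_sub_apply (r s : AddMonoid.End N) (a : N) : (r - s) a = r a - s a := rfl

theorem end_neg_apply (r : AddMonoid.End N) (a : N) : (-r) a = -r a := rfl

/-- The commutator with a left multiplication. -/
def ad (a : N) (r : AddMonoid.End N) : AddMonoid.End N := lmul a * r - r * lmul a

theorem ad_apply (a : N) (r : AddMonoid.End N) (b : N) : ad a r b = a * r b - r (a * b) := rfl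

theorem ad_mul (a : N) (r s : AddMonoid.End N) : ad a (r * s) = ad a r * s + r * ad a s := by
  simp only [ad]; noncomm_ring

theorem ad_add (a : N) (r s : AddMonoid.End N) : ad a (r + s) = ad a r + ad a s := by
  simp only [ad]; noncomm_ring

theorem ad_neg (a : N) (r : AddMonoid.End N) : ad a (-r) = -ad a r := by
  simp only [ad]; noncomm_ring

theorem ad_zero (a : N) : ad a 0 = 0 := by simp [ad]

theorem ad_add_left (a b : N) (r : AddMonoid.End N) : ad (a + b) r = ad a r + ad b r := by
  ext x
  simp only [ad_apply, end_add_apply, add_mul, map_add]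
  abel

/-- The sum of the values of `F` at the lists obtained from a given list by multiplying one of its
entries by `a` on the left. -/
def lieSum (a : N) (F : List N → AddMonoid.End N) : List N → AddMonoid.End N
  | [] => 0
  | u :: l => F (a * u :: l) + lieSum a (fun l' => F (u :: l')) l

theorem lieSum_congr (a : N) {F G : List N → AddMonoid.End N} (l : List N)
    (h : ∀ l', l'.length = l.length → F l' = G l') : lieSum a F l = lieSum a G l := by
  induction l generalizing F G with
  | nil => rfl
  | cons u l ih =>
    simp only [lieSum]
    rw [h _ (by simp), ih fun l' hl' => h _ (by simp [hl'])]

theorem lieSum_zero (a : N) (l : List N) : lieSum a (fun _ => 0) l = 0 := by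
  induction l with
  | nil => rfl
  | cons u l ih => rw [lieSum, ih, add_zero]

theorem lieSum_append (a : N) (F : List N → AddMonoid.End N) (l₁ l₂ : List N) :
    lieSum a F (l₁ ++ l₂) =
      lieSum a (fun l => F (l ++ l₂)) l₁ + lieSum a (fun l => F (l₁ ++ l)) l₂ := by
  induction l₁ generalizing F with
  | nil => simp [lieSum]
  | cons u l ih => simp only [List.cons_append, lieSum, ih, add_assoc]

theorem lieSum_mul_right (a : N) (F : List N → AddMonoid.End N) (r : AddMonoid.End N)
    (l : List N) : lieSum a (fun l => F l * r) l = lieSum a F l * r := by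
  induction l generalizing F with
  | nil => simp [lieSum]
  | cons u l ih => simp only [lieSum, add_mul, ih]

theorem lieSum_mul_left (a : N) (F : List N → AddMonoid.End N) (r : AddMonoid.End N)
    (l : List N) : lieSum a (fun l => r * F l) l = r * lieSum a F l := by
  induction l generalizing F with
  | nil => simp [lieSum]
  | cons u l ih => simp only [lieSum, mul_add, ih]

/-- The derivative of a family of operators. -/
def familyDeriv (F : List N → AddMonoid.End N) : List N → AddMonoid.End N
  | [] => 0
  | a :: l => ad a (F l) - lieSum a F l

/-- The concatenation product of families of operators, the first of degree `m`. -/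
def familyMul (m : ℕ) (F G : List N → AddMonoid.End N) (l : List N) : AddMonoid.End N :=
  F (l.take m) * G (l.drop m)

/-! ### Symmetric multilinear families of operators -/

/-- Symmetric families of operators that are linear over the right multiplications in each entry
and allow to exchange an entry with the argument. -/
structure IsSymmFamily (F : List N → AddMonoid.End N) : Prop where
  mem : ∀ l, F l ∈ rightOps N
  perm : ∀ {l l'}, l.Perm l' → F l = F l'
  add : ∀ a b l, F ((a + b) :: l) = F (a :: l) + F (b :: l)
  smul : ∀ r ∈ rightOps N, ∀ a l, F (r a :: l) = r * F (a :: l)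
  exch : ∀ a b l, F (a :: l) b = F (b :: l) a

namespace IsSymmFamily

variable {F G : List N → AddMonoid.End N}

theorem swap (hF : IsSymmFamily F) (a b : N) (l : List N) : F (a :: b :: l) = F (b :: a :: l) :=
  hF.perm (List.Perm.swap b a l)

theorem tail (hF : IsSymmFamily F) (u : N) : IsSymmFamily fun l => F (u :: l) where
  mem l := hF.mem _
  perm h := hF.perm (h.cons u)
  add a b l := by rw [hF.swap, hF.add, hF.swap, hF.swap b]
  smul r hr a l := by rw [hF.swap, hF.smul r hr, hF.swap]
  exch a b l := by rw [hF.swap, hF.exch, hF.swap]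

theorem mul_head (hF : IsSymmFamily F) (a u : N) (l : List N) :
    F (a * u :: l) = rmul u * F (a :: l) :=
  hF.smul _ (rmul_mem u) a l

theorem lieSum_mem (hF : IsSymmFamily F) (a : N) (l : List N) : lieSum a F l ∈ rightOps N := by
  induction l generalizing F with
  | nil => exact zero_mem _
  | cons u l ih => exact add_mem (hF.mem _) (ih (hF.tail u))

theorem lieSum_perm (hF : IsSymmFamily F) (a : N) {l l' : List N} (h : l.Perm l') :
    lieSum a F l = lieSum a F l' := by
  induction h generalizing F with
  | nil => rfl
  | cons u h ih => rw [lieSum, lieSum, ih (hF.tail u), hF.perm (h.cons _)]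
  | swap u v l =>
    have : (fun l' => F (v :: u :: l')) = fun l' => F (u :: v :: l') :=
      funext fun l' => hF.swap _ _ _
    simp only [lieSum]
    rw [this, hF.swap (a * v), hF.swap v (a * u)]
    abel
  | trans _ _ ih ih' => exact (ih hF).trans (ih' hF)

theorem lieSum_add (hF : IsSymmFamily F) (a b : N) (l : List N) :
    lieSum (a + b) F l = lieSum a F l + lieSum b F l := by
  induction l generalizing F with
  | nil => exact (add_zero 0).symm
  | cons u l ih =>
    simp only [lieSum]
    rw [ih (hF.tail u), add_mul, hF.add]
    abel

theorem lieSum_exch (hF : IsSymmFamily F) (a b : N) (l : List N) :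
    lieSum a F l b = lieSum b F l a := by
  induction l generalizing F with
  | nil => rfl
  | cons u l ih =>
    simp only [lieSum, end_add_apply]
    rw [ih (hF.tail u), hF.mul_head, hF.mul_head, end_mul_apply,
      end_mul_apply, hF.exch]

/-- Pulling `u` out of the entry `a * u` leaves `rmul u * F (b :: a :: l)`, which is symmetric in
`a` and `b`. This is half of the symmetry of `familyDeriv` in its first two entries. -/
theorem lieSum_swap (hF : IsSymmFamily F) (a b : N) (l : List N) :
    lieSum a (fun l' => F (b :: l')) l = lieSum b (fun l' => F (a :: l')) l := by
  induction l generalizing F with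
  | nil => rfl
  | cons u l ih =>
    have h : ∀ c, (fun l' => F (c :: u :: l')) = fun l' => F (u :: c :: l') :=
      fun c => funext fun l' => hF.swap _ _ _
    simp only [lieSum]
    rw [h, h, ih (hF.tail u), (hF.tail b).mul_head, (hF.tail a).mul_head, hF.swap a b]

end IsSymmFamily

/-! ### Consequences of the Novikov identities for operators and families -/

variable [IsNovikov N]

theorem rightOps_comm {r s : AddMonoid.End N} (hr : r ∈ rightOps N) (hs : s ∈ rightOps N) :
    r * s = s * r := by
  have key : ∀ b : N, ∀ s ∈ rightOps N, rmul b * s = s * rmul b := by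
    intro b s hs
    induction hs using rightOps_induction with
    | one => simp
    | zero => simp
    | rmul c => ext x; exact right_comm x c b
    | add r _ s _ h h' => rw [mul_add, add_mul, h, h']
    | neg r _ h => rw [mul_neg, neg_mul, h]
    | mul r _ s _ h h' => rw [← mul_assoc, h, mul_assoc, h', mul_assoc]
  induction hr using rightOps_induction with
  | one => simp
  | zero => simp
  | rmul b => exact key b s hs
  | add r _ s _ h h' => rw [mul_add, add_mul, h, h']
  | neg r _ h => rw [mul_neg, neg_mul, h]
  | mul r _ s _ h h' => rw [mul_assoc, h', ← mul_assoc, h, mul_assoc]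

theorem rightOps_comm_apply {r s : AddMonoid.End N} (hr : r ∈ rightOps N) (hs : s ∈ rightOps N)
    (a : N) : r (s a) = s (r a) :=
  DFunLike.congr_fun (rightOps_comm hr hs) a

/-- Multiplication on the right by `b` is itself one of the commuting operators, so the product is
linear over `rightOps N` in its left factor. -/
theorem rightOps_mul {r : AddMonoid.End N} (hr : r ∈ rightOps N) (a b : N) :
    r a * b = r (a * b) :=
  rightOps_comm_apply (rmul_mem b) hr a

/-- On generators this is left symmetry, solved for the commutator as an expression in right
multiplications; the derivation rule for `ad a` extends it to products. -/
theorem ad_mem (a : N) {r : AddMonoid.End N} (hr : r ∈ rightOps N) : ad a r ∈ rightOps N := by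
  induction hr using rightOps_induction with
  | one => simp [ad]
  | zero => simp [ad]
  | rmul b =>
    have : ad a (rmul b) = rmul (a * b) - rmul b * rmul a := by
      ext x
      have := left_symm a x b
      simp only [ad_apply, rmul_apply, end_sub_apply, end_mul_apply]
      rw [← neg_inj, neg_sub, neg_sub]
      exact this
    rw [this]
    exact sub_mem (rmul_mem _) (mul_mem (rmul_mem _) (rmul_mem _))
  | add r _ s _ h h' =>
    rw [ad_add]; exact add_mem h h'
  | neg r _ h =>
    rw [ad_neg]; exact neg_mem h
  | mul r hr s hs h h' =>
    rw [ad_mul]; exact add_mem (mul_mem h hs) (mul_mem hr h')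

/-- For a right multiplication this is left symmetry verbatim: both sides are negated associators.
For a product `r * s`, the term `ad a r (s b)` becomes `ad (s b) r a`, and `s` can be pulled out of
it because right operators commute. -/
theorem ad_exchange {r : AddMonoid.End N} (hr : r ∈ rightOps N) (a b : N) :
    ad a r b = ad b r a := by
  induction hr using rightOps_induction generalizing a b with
  | one => simp [ad_apply]
  | zero => simp [ad_apply]
  | rmul c =>
    have := left_symm a b c
    simp only [ad_apply, rmul_apply]
    rw [← neg_inj, neg_sub, neg_sub]
    exact this
  | add r _ s _ h h' =>
    simp only [ad_add, end_add_apply, h a b, h' a b]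
  | neg r _ h =>
    simp only [ad_neg, end_neg_apply, h a b]
  | mul r hr s hs h h' =>
    simp only [ad_mul, end_add_apply, end_mul_apply]
    rw [h a (s b), h' a b, ad_apply (s b), rightOps_mul hs, rightOps_mul hs,
      rightOps_comm_apply (ad_mem b hr) hs, ad_apply b r a, map_sub,
      rightOps_comm_apply hr hs]

theorem ad_smul_left {r s : AddMonoid.End N} (hr : r ∈ rightOps N) (hs : s ∈ rightOps N) (a : N) :
    ad (r a) s = r * ad a s := by
  ext b
  rw [ad_apply, rightOps_mul hr, rightOps_mul hr, rightOps_comm_apply hs hr, ← map_sub]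
  rfl

namespace IsSymmFamily

variable {F G : List N → AddMonoid.End N}

theorem lieSum_smul (hF : IsSymmFamily F) {r : AddMonoid.End N} (hr : r ∈ rightOps N) (a : N)
    (l : List N) : lieSum (r a) F l = r * lieSum a F l := by
  induction l generalizing F with
  | nil => exact (mul_zero r).symm
  | cons u l ih =>
    simp only [lieSum]
    rw [ih (hF.tail u), rightOps_mul hr, hF.smul r hr, mul_add]

/-- Each axiom for the derivative splits into a statement about `ad` and one about `lieSum`, except
for symmetry in the first two entries, where the two parts compensate each other. -/
theorem familyDeriv (hF : IsSymmFamily F) : IsSymmFamily (familyDeriv F) where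
  mem
    | [] => zero_mem _
    | a :: l => sub_mem (ad_mem a (hF.mem l)) (hF.lieSum_mem a l)
  perm {l l'} h := by
    induction h with
    | nil => rfl
    | cons u h ih =>
      simp only [IsNovikov.familyDeriv]
      rw [hF.lieSum_perm u h, hF.perm h]
    | swap u v l =>
      simp only [IsNovikov.familyDeriv, lieSum]
      rw [hF.lieSum_swap]
      -- Exchange the test argument `x` with the differentiating entry and expand the commutator.
      -- The leading terms agree by `exch`; the others are of the form `rmul u (F (v :: l) x)` and
      -- `rmul v (F (u :: l) x)`, one of each on either side.
      ext x
      simp only [end_sub_apply, end_add_apply]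
      rw [ad_exchange (hF.mem _) v x, ad_exchange (hF.mem _) u x, ad_apply, ad_apply,
        hF.exch u v, hF.exch u (x * v), hF.mul_head, end_mul_apply, hF.exch x,
        hF.exch v (x * u), hF.mul_head, end_mul_apply, hF.mul_head x u,
        hF.mul_head u v, end_mul_apply, end_mul_apply, hF.exch x v]
      abel
    | trans _ _ ih ih' => exact ih.trans ih'
  add a b l := by
    simp only [IsNovikov.familyDeriv]
    rw [ad_add_left, hF.lieSum_add]
    abel
  smul r hr a l := by
    simp only [IsNovikov.familyDeriv]
    rw [ad_smul_left hr (hF.mem l), hF.lieSum_smul hr, mul_sub]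
  exch a b l := by
    simp only [IsNovikov.familyDeriv, end_sub_apply]
    rw [ad_exchange (hF.mem l), hF.lieSum_exch]

/-- Cutting the list at position `m` is harmless: transpositions inside a block are the symmetry of
one factor, and a transposition across the cut can be carried out by passing each entry through the
argument. -/
theorem familyMul (hF : IsSymmFamily F) (hG : IsSymmFamily G) (m : ℕ) :
    IsSymmFamily (familyMul m F G) where
  mem l := mul_mem (hF.mem _) (hG.mem _)
  perm {l l'} h := by
    induction h generalizing F m with
    | nil => rfl
    | cons u h ih =>
      rcases m with _ | m
      · exact congrArg (F [] * ·) (hG.perm (h.cons u))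
      · exact ih (hF.tail u) m
    | swap u v l =>
      rcases m with _ | _ | m
      · exact congrArg (F [] * ·) (hG.swap _ _ _)
      -- The transposition across the cut: `u` trades places with `x`, then with `v` after the
      -- factors are commuted, and finally `v` trades places with `x`.
      · ext x
        change F [v] (G (u :: l) x) = F [u] (G (v :: l) x)
        rw [hG.exch, rightOps_comm_apply (hF.mem _) (hG.mem _), hF.exch,
          rightOps_comm_apply (hG.mem _) (hF.mem _), hG.exch]
      · exact congrArg (· * G (l.drop m)) (hF.swap _ _ _)
    | trans _ _ ih ih' => exact (ih hF m).trans (ih' hF m)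
  add a b l := by
    rcases m with _ | m <;> simp [IsNovikov.familyMul, hF.add, hG.add, mul_add, add_mul]
  smul r hr a l := by
    rcases m with _ | m
    · simp only [IsNovikov.familyMul, List.take_zero, List.drop_zero, hG.smul r hr]
      rw [← mul_assoc, rightOps_comm (hF.mem _) hr, mul_assoc]
    · simp only [IsNovikov.familyMul, List.take_succ_cons, List.drop_succ_cons, hF.smul r hr,
        mul_assoc]
  exch a b l := by
    rcases m with _ | m
    · simp only [IsNovikov.familyMul, List.take_zero, List.drop_zero, end_mul_apply,
        hG.exch a]
    · simp only [IsNovikov.familyMul, List.take_succ_cons, List.drop_succ_cons,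
        rightOps_comm (hF.mem _) (hG.mem _), end_mul_apply, hF.exch a]

end IsSymmFamily

end IsNovikov

/-! ### Leibniz rule and the commutative monoid of homogeneous families -/

namespace IsNovikov

variable {N : Type*} [NonUnitalNonAssocRing N]

/-- Both ingredients of the derivative obey a product rule: `ad a` is a derivation, and replacing
one entry of a concatenation affects just one of the two blocks. -/
theorem familyDeriv_familyMul {F G : List N → AddMonoid.End N} (m : ℕ) (a : N) {l : List N}
    (h : m ≤ l.length) : familyDeriv (familyMul m F G) (a :: l) =
      familyDeriv F (a :: l.take m) * G (l.drop m) +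
        F (l.take m) * familyDeriv G (a :: l.drop m) := by
  obtain ⟨l₁, l₂, rfl, rfl⟩ : ∃ l₁ l₂, l = l₁ ++ l₂ ∧ l₁.length = m :=
    ⟨l.take m, l.drop m, (List.take_append_drop m l).symm, by simp [h]⟩
  have h₁ : lieSum a (fun l => familyMul l₁.length F G (l ++ l₂)) l₁ = lieSum a F l₁ * G l₂ := by
    rw [← lieSum_mul_right]
    refine lieSum_congr a _ fun l hl => ?_
    simp [familyMul, ← hl]
  have h₂ : lieSum a (fun l => familyMul l₁.length F G (l₁ ++ l)) l₂ = F l₁ * lieSum a G l₂ := by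
    rw [← lieSum_mul_left]
    refine lieSum_congr a _ fun l _ => ?_
    simp [familyMul]
  have h₃ : familyMul l₁.length F G (l₁ ++ l₂) = F l₁ * G l₂ := by simp [familyMul]
  simp only [familyDeriv, List.take_left', List.drop_left']
  rw [lieSum_append, h₁, h₂, h₃, ad_mul]
  noncomm_ring

/-- The sum of the values of `f` at the pairs consisting of an entry of a list and the list of the
remaining entries. -/
def delSum {A E : Type*} [AddZeroClass E] (f : A → List A → E) : List A → E
  | [] => 0
  | u :: l => f u l + delSum (fun v l' => f v (u :: l')) l

theorem delSum_congr {A E : Type*} [AddZeroClass E] {f g : A → List A → E} (l : List A)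
    (h : ∀ u l', l'.length + 1 = l.length → f u l' = g u l') : delSum f l = delSum g l := by
  induction l generalizing f g with
  | nil => rfl
  | cons u l ih =>
    simp only [delSum]
    rw [h _ _ (by simp), ih fun v l' hl' => h _ _ (by simp [hl'])]

theorem map_delSum {A E E' : Type*} [AddZeroClass E] [AddZeroClass E'] (φ : E →+ E')
    (f : A → List A → E) (l : List A) : φ (delSum f l) = delSum (fun u l' => φ (f u l')) l := by
  induction l generalizing f with
  | nil => exact map_zero φ
  | cons u l ih => rw [delSum, delSum, map_add, ih]

/-- By linearity over right multiplications, an entry `a * u` equals an entry `a` followed by the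
operator `rmul u`. Thus differentiating one order-zero factor `u` and putting `a` in its place is
the correction term of the derivative. -/
theorem IsSymmFamily.delSum_rmul {F : List N → AddMonoid.End N} [IsNovikov N]
    (hF : IsSymmFamily F) (a : N) (l : List N) :
    delSum (fun u l' => F (a :: l') * rmul u) l = lieSum a F l := by
  induction l generalizing F with
  | nil => rfl
  | cons u l ih =>
    simp only [delSum, lieSum]
    rw [hF.mul_head, rightOps_comm (hF.mem _) (rmul_mem u), ← ih (hF.tail u)]
    simp only [hF.swap a u]

variable (N) in
/-- Homogeneous symmetric families of operators. -/
@[ext] structure SymmFamily where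
  deg : ℕ
  toFun : List N → AddMonoid.End N
  isSymm : IsSymmFamily toFun
  eq_zero : ∀ l, l.length ≠ deg → toFun l = 0

namespace SymmFamily

/-- An operator as a family of degree zero. -/
def ofOp (r : AddMonoid.End N) (hr : r ∈ rightOps N) : SymmFamily N where
  deg := 0
  toFun
    | [] => r
    | _ :: _ => 0
  isSymm :=
    { mem := by rintro (_ | _); exacts [hr, zero_mem _]
      perm := fun {l l'} h => by
        have := h.length_eq
        rcases l with _ | _ <;> rcases l' with _ | _ <;> simp_all
      add := fun _ _ _ => (add_zero 0).symm
      smul := fun r _ _ _ => (mul_zero r).symm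
      exch := fun _ _ _ => rfl }
  eq_zero := by rintro (_ | _) h; exacts [absurd rfl h, rfl]

instance : One (SymmFamily N) where
  one := ofOp 1 (one_mem _)

/-- The value of a family of degree `m` at a multiset of `m + 1` elements. -/
def eval (F : SymmFamily N) : Multiset N → N :=
  Quotient.lift (fun l : List N => match l with
    | [] => 0
    | a :: l => F.toFun l a) (by
    intro l l' h
    induction (h : l.Perm l') with
    | nil => rfl
    | cons a h => exact DFunLike.congr_fun (F.isSymm.perm h) a
    -- The head of the list is the argument of the operator, so this transposition is the exchange
    -- axiom rather than symmetry of the entries.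
    | swap a b l => exact F.isSymm.exch _ _ _
    | trans _ _ ih ih' => exact ih.trans ih')

theorem eval_cons (F : SymmFamily N) (a : N) (l : List N) :
    F.eval ((a :: l : List N) : Multiset N) = F.toFun l a := rfl

/-- Families form only a monoid, with no addition; this is how a pointwise sum such as the Leibniz
rule enters the evaluation. -/
theorem eval_congr {F G H : SymmFamily N} (h : ∀ l, F.toFun l = G.toFun l + H.toFun l)
    (M : Multiset N) : F.eval M = G.eval M + H.eval M := by
  induction M using Quotient.inductionOn with
  | h l =>
    rcases l with _ | ⟨a, l⟩
    · exact (add_zero 0).symm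
    · exact DFunLike.congr_fun (h l) a

variable [IsNovikov N]

/-- The derivative. -/
def deriv (F : SymmFamily N) : SymmFamily N where
  deg := F.deg + 1
  toFun := familyDeriv F.toFun
  isSymm := F.isSymm.familyDeriv
  eq_zero := by
    rintro (_ | ⟨a, l⟩) h
    · rfl
    · have h' : l.length ≠ F.deg := fun e => h (by simp [e])
      simp only [familyDeriv]
      rw [F.eq_zero l h', ad_zero, lieSum_congr a l fun l' hl' => F.eq_zero l' (hl' ▸ h'),
        lieSum_zero, sub_zero]

instance : Mul (SymmFamily N) where
  mul F G :=
    { deg := F.deg + G.deg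
      toFun := familyMul F.deg F.toFun G.toFun
      isSymm := F.isSymm.familyMul G.isSymm _
      eq_zero := by
        intro l h
        by_cases h' : F.deg ≤ l.length
        · rw [familyMul, G.eq_zero, mul_zero]
          rw [List.length_drop]
          omega
        · rw [familyMul, F.eq_zero, zero_mul]
          rw [List.length_take]
          omega }

theorem mul_toFun (F G : SymmFamily N) (l : List N) :
    (F * G).toFun l = F.toFun (l.take F.deg) * G.toFun (l.drop F.deg) := rfl

theorem mul_toFun_append (F G : SymmFamily N) {l l' : List N} (h : l.length = F.deg) :
    (F * G).toFun (l ++ l') = F.toFun l * G.toFun l' := by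
  simp [mul_toFun, ← h]

@[simp] theorem mul_deg (F G : SymmFamily N) : (F * G).deg = F.deg + G.deg := rfl

@[simp] theorem deriv_deg (F : SymmFamily N) : F.deriv.deg = F.deg + 1 := rfl

instance : CommMonoid (SymmFamily N) where
  mul_assoc F G H := by
    refine SymmFamily.ext (Nat.add_assoc _ _ _) (funext fun l => ?_)
    simp only [mul_toFun, mul_deg, mul_assoc, List.take_take, List.drop_take, List.drop_drop]
    simp
  one_mul F := by
    refine SymmFamily.ext (Nat.zero_add _) (funext fun l => ?_)
    exact one_mul _
  mul_one F := by
    refine SymmFamily.ext (Nat.add_zero _) (funext fun l => ?_)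
    by_cases h : l.length = F.deg
    · have := mul_toFun_append F 1 (l' := []) h
      rw [List.append_nil] at this
      exact this.trans (mul_one _)
    · rw [F.eq_zero l h, (F * 1).eq_zero l h]
  mul_comm F G := by
    refine SymmFamily.ext (Nat.add_comm _ _) (funext fun l => ?_)
    by_cases h : l.length = F.deg + G.deg
    · obtain ⟨l₁, l₂, rfl, h₁⟩ : ∃ l₁ l₂, l = l₁ ++ l₂ ∧ l₁.length = F.deg :=
        ⟨l.take F.deg, l.drop F.deg, (List.take_append_drop _ l).symm, by simp [h]⟩
      have h₂ : l₂.length = G.deg := by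
        rw [List.length_append] at h
        omega
      rw [mul_toFun_append _ _ h₁, (G * F).isSymm.perm List.perm_append_comm,
        mul_toFun_append _ _ h₂, rightOps_comm (F.isSymm.mem _) (G.isSymm.mem _)]
    · rw [(F * G).eq_zero l h, (G * F).eq_zero l (by rwa [mul_deg, add_comm])]

theorem deriv_mul (F G : SymmFamily N) (l : List N) :
    (F * G).deriv.toFun l = (F.deriv * G).toFun l + (F * G.deriv).toFun l := by
  by_cases h : l.length = F.deg + G.deg + 1
  · obtain ⟨a, l, rfl⟩ := List.exists_cons_of_length_eq_add_one h
    have h' : F.deg ≤ l.length := by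
      simp only [List.length_cons] at h
      omega
    -- In the term `F * G.deriv` the new entry `a` must head the block of `G.deriv`, so it is moved
    -- past the first `F.deg` entries.
    have hp : (a :: l).Perm (l.take F.deg ++ a :: l.drop F.deg) := by
      conv_lhs => rw [← List.take_append_drop F.deg l]
      exact List.perm_middle.symm
    rw [(F * G.deriv).isSymm.perm hp, mul_toFun_append _ _ (by simp [h'])]
    exact familyDeriv_familyMul _ _ h'
  · rw [SymmFamily.eq_zero _ l h, SymmFamily.eq_zero, SymmFamily.eq_zero, add_zero]
    · simp only [mul_deg, deriv_deg]; omega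
    · simp only [mul_deg, deriv_deg]; omega

/-- The family corresponding to the derivative of order `j + 1` of an element. -/
def symbol (b : N) (j : ℕ) : SymmFamily N := deriv^[j] (ofOp (rmul b) (rmul_mem b))

theorem symbol_succ (b : N) (j : ℕ) : symbol b (j + 1) = (symbol b j).deriv :=
  Function.iterate_succ_apply' _ _ _

@[simp] theorem symbol_deg (b : N) (j : ℕ) : (symbol b j).deg = j := by
  induction j with
  | zero => rfl
  | succ j ih => rw [symbol_succ, deriv_deg, ih]

end SymmFamily

variable [IsNovikov N]

/-! ### Novikov words and differential polynomials -/

section DiffPoly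

open SymmFamily MvPolynomial

variable {k : Type u} [Field k] {X : Type}

variable (N k) in
/-- Formal linear combinations of pairs of a family of operators and a multiset of arguments. -/
abbrev FamilyAlgebra : Type _ := MonoidAlgebra k (SymmFamily N × Multiplicative (Multiset N))

variable (k) in
/-- A pair of a family of operators and a multiset of arguments. -/
noncomputable def pair (F : SymmFamily N) (M : Multiset N) : FamilyAlgebra N k :=
  MonoidAlgebra.of k _ (F, Multiplicative.ofAdd M)

theorem pair_mul (F G : SymmFamily N) (M M' : Multiset N) :
    pair k F M * pair k G M' = pair k (F * G) (M + M') :=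
  (map_mul (MonoidAlgebra.of k _) _ _).symm

variable (k X) in
/-- The derivation of the algebra of differential polynomials. -/
noncomputable def diff : Derivation k (MvPolynomial (X × ℕ) k) (MvPolynomial (X × ℕ) k) :=
  mkDerivation k fun p => MvPolynomial.X (p.1, p.2 + 1)

@[simp] theorem diff_X (x : X) (j : ℕ) :
    diff k X (MvPolynomial.X (x, j)) = MvPolynomial.X (x, j + 1) :=
  mkDerivation_X _ _ _

variable (k) in
/-- The formal pairs corresponding to differential monomials. -/
noncomputable def toPair (g : X → N) : MvPolynomial (X × ℕ) k →ₐ[k] FamilyAlgebra N k :=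
  aeval fun p => match p with
    | (x, 0) => pair k 1 {g x}
    | (x, j + 1) => pair k (symbol (g x) j) 0

@[simp] theorem toPair_X_zero (g : X → N) (x : X) :
    toPair k g (MvPolynomial.X (x, 0)) = pair k 1 {g x} := aeval_X _ _

@[simp] theorem toPair_X_succ (g : X → N) (x : X) (j : ℕ) :
    toPair k g (MvPolynomial.X (x, j + 1)) = pair k (symbol (g x) j) 0 := aeval_X _ _

/-- Differential monomials together with the corresponding families and lists of arguments. -/
inductive IsDiffMonomial (g : X → N) :
    MvPolynomial (X × ℕ) k → SymmFamily N → List N → Prop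
  | one : IsDiffMonomial g 1 1 []
  | zero (x : X) {p F l} : IsDiffMonomial g p F l →
      IsDiffMonomial g (MvPolynomial.X (x, 0) * p) F (g x :: l)
  | succ (x : X) (j : ℕ) {p F l} : IsDiffMonomial g p F l →
      IsDiffMonomial g (MvPolynomial.X (x, j + 1) * p) (symbol (g x) j * F) l

namespace IsDiffMonomial

variable {g : X → N} {p q : MvPolynomial (X × ℕ) k} {F G : SymmFamily N} {l l' : List N}

theorem mul (hp : IsDiffMonomial g p F l) (hq : IsDiffMonomial g q G l') :
    IsDiffMonomial g (p * q) (F * G) (l ++ l') := by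
  induction hp with
  | one => simpa using hq
  | zero x _ ih => rw [mul_assoc]; exact .zero x ih
  | succ x j _ ih => rw [mul_assoc, mul_assoc]; exact .succ x j ih

theorem toPair_eq (hp : IsDiffMonomial g p F l) : toPair k g p = pair k F l := by
  induction hp with
  | one => exact map_one _
  | zero x _ ih => rw [map_mul, ih, toPair_X_zero, pair_mul, one_mul]; rfl
  | succ x j _ ih => rw [map_mul, ih, toPair_X_succ, pair_mul, zero_add]

end IsDiffMonomial

variable (k) in
/-- The differential polynomial corresponding to a nonassociative word. -/
noncomputable def diffWord : FreeMagma X → MvPolynomial (X × ℕ) k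
  | .of x => MvPolynomial.X (x, 0)
  | .mul u v => diffWord u * diff k X (diffWord v)

variable (k) in
/-- The span of the differential monomials of weight `-1`. -/
noncomputable def weightNegOne (g : X → N) : Submodule k (MvPolynomial (X × ℕ) k) :=
  Submodule.span k {p | ∃ F l, IsDiffMonomial g p F l ∧ l.length = F.deg + 1}

/-- Differentiation raises the weight by one: an order-zero factor turns into a symbol of degree
zero and leaves the list of arguments, while a symbol of degree `j` turns into one of degree `j +
1`. -/
theorem IsDiffMonomial.diff_mem {g : X → N} {p : MvPolynomial (X × ℕ) k} {F : SymmFamily N}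
    {l : List N} (hp : IsDiffMonomial g p F l) : diff k X p ∈ Submodule.span k
      {q | ∃ G l', IsDiffMonomial g q G l' ∧ l'.length + F.deg + 1 = l.length + G.deg} := by
  induction hp with
  | one => rw [Derivation.map_one_eq_zero]; exact zero_mem _
  | @zero x p F l hp ih =>
    rw [Derivation.leibniz, smul_eq_mul, smul_eq_mul, diff_X, mul_comm p]
    refine add_mem ?_ (Submodule.subset_span ⟨_, _, hp.succ x 0, ?_⟩)
    · refine Submodule.span_le.2 ?_ (Submodule.apply_mem_span_image_of_mem_span
        (LinearMap.mulLeft k (MvPolynomial.X (x, 0))) ih)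
      rintro _ ⟨q, ⟨G, l', hq, h⟩, rfl⟩
      refine Submodule.subset_span ⟨_, _, hq.zero x, ?_⟩
      simp only [List.length_cons]
      omega
    · simp only [List.length_cons, mul_deg, symbol_deg]
      omega
  | @succ x j p F l hp ih =>
    rw [Derivation.leibniz, smul_eq_mul, smul_eq_mul, diff_X, mul_comm p]
    refine add_mem ?_ (Submodule.subset_span ⟨_, _, hp.succ x (j + 1), ?_⟩)
    · refine Submodule.span_le.2 ?_ (Submodule.apply_mem_span_image_of_mem_span
        (LinearMap.mulLeft k (MvPolynomial.X (x, j + 1))) ih)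
      rintro _ ⟨q, ⟨G, l', hq, h⟩, rfl⟩
      refine Submodule.subset_span ⟨_, _, hq.succ x j, ?_⟩
      simp only [mul_deg, symbol_deg]
      omega
    · simp only [mul_deg, symbol_deg]
      omega

theorem mul_diff_mem {g : X → N} {p q : MvPolynomial (X × ℕ) k} (hp : p ∈ weightNegOne k g)
    (hq : q ∈ weightNegOne k g) : p * diff k X q ∈ weightNegOne k g := by
  induction hp using Submodule.span_induction with
  | zero => rw [zero_mul]; exact zero_mem _
  | add x y _ _ hx hy => rw [add_mul]; exact add_mem hx hy
  | smul c x _ hx => rw [smul_mul_assoc]; exact Submodule.smul_mem _ _ hx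
  | mem p hp =>
    obtain ⟨F, l, hp, hl⟩ := hp
    induction hq using Submodule.span_induction with
    | zero => rw [map_zero, mul_zero]; exact zero_mem _
    | add x y _ _ hx hy => rw [map_add, mul_add]; exact add_mem hx hy
    | smul c x _ hx => rw [Derivation.map_smul, mul_smul_comm]; exact Submodule.smul_mem _ _ hx
    | mem q hq =>
      obtain ⟨G, l', hq, hl'⟩ := hq
      refine Submodule.span_le.2 ?_ (Submodule.apply_mem_span_image_of_mem_span
        (LinearMap.mulLeft k p) hq.diff_mem)
      rintro _ ⟨q', ⟨G', l'', hq', h⟩, rfl⟩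
      refine Submodule.subset_span ⟨_, _, hp.mul hq', ?_⟩
      simp only [List.length_append, mul_deg]
      omega

variable [Module k N]

variable (N k) in
/-- The evaluation of formal pairs. -/
noncomputable def evalPair : FamilyAlgebra N k →ₗ[k] N :=
  (Finsupp.linearCombination k
    fun p : SymmFamily N × Multiplicative (Multiset N) => p.1.eval p.2.toAdd) ∘ₗ
      (MonoidAlgebra.coeffLinearEquiv k).toLinearMap

@[simp] theorem evalPair_pair (F : SymmFamily N) (M : Multiset N) :
    evalPair N k (pair k F M) = F.eval M := by
  change Finsupp.linearCombination k _ (Finsupp.single _ _) = _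
  rw [Finsupp.linearCombination_single, one_smul]
  rfl

namespace IsDiffMonomial

variable {g : X → N} {p q : MvPolynomial (X × ℕ) k} {F G : SymmFamily N} {l l' : List N}

/-- The derivative falls either on the operator part, giving `F.deriv`, or on one order-zero factor
`u`, giving `symbol u 0`. The spectators `H` and `M` are carried along so that the induction can
peel off one factor of the monomial at a time. -/
theorem evalPair_diff (hp : IsDiffMonomial g p F l) (H : SymmFamily N) (M : Multiset N) :
    evalPair N k (pair k H M * toPair k g (diff k X p)) = (H * F.deriv).eval (M + l) +
      delSum (fun u l' => (H * F * symbol u 0).eval (M + (l' : List N))) l := by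
  induction hp generalizing H M with
  | one =>
    -- In its only relevant degree, one, the derivative of the unit family is the commutator of a
    -- left multiplication with the identity.
    have h : ∀ l, (1 : SymmFamily N).deriv.toFun l = 0 := by
      rintro (_ | ⟨a, _ | ⟨b, l⟩⟩)
      · rfl
      · change lmul a * 1 - 1 * lmul a - 0 = 0
        simp
      · exact SymmFamily.eq_zero _ _ (Nat.succ_ne_zero _ ∘ Nat.succ.inj)
    have h' : ∀ l, (H * (1 : SymmFamily N).deriv).toFun l = 0 := fun l => by
      rw [mul_toFun, h, mul_zero]
    have h'' : (H * (1 : SymmFamily N).deriv).eval (M + (([] : List N) : Multiset N)) = 0 := by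
      -- A family vanishing pointwise is its own double, so its value `e` satisfies `e = e + e`.
      have := eval_congr (F := H * (1 : SymmFamily N).deriv) (G := H * (1 : SymmFamily N).deriv)
        (H := H * (1 : SymmFamily N).deriv) (fun l => by rw [h', add_zero])
        (M + (([] : List N) : Multiset N))
      exact left_eq_add.1 this
    rw [Derivation.map_one_eq_zero, map_zero, mul_zero, map_zero, h'']
    exact (add_zero 0).symm
  | @zero x p F l hp ih =>
    rw [Derivation.leibniz, map_add, smul_eq_mul, smul_eq_mul,
      map_mul (toPair k g), map_mul (toPair k g), mul_add, map_add,
      ← mul_assoc, toPair_X_zero, pair_mul, mul_one, ih, diff_X, toPair_X_succ, hp.toPair_eq,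
      pair_mul, pair_mul, evalPair_pair, add_zero]
    have h : ∀ l' : List N,
        M + {g x} + (l' : Multiset N) = M + ((g x :: l' : List N) : Multiset N) := fun l' => by
      rw [add_assoc]; rfl
    simp only [delSum, h, mul_comm F, mul_assoc]
    abel
  | @succ x j p F l hp ih =>
    rw [Derivation.leibniz, map_add, smul_eq_mul, smul_eq_mul,
      map_mul (toPair k g), map_mul (toPair k g), mul_add, map_add,
      ← mul_assoc, toPair_X_succ, pair_mul, add_zero, ih, diff_X, toPair_X_succ, hp.toPair_eq,
      pair_mul, pair_mul, evalPair_pair, add_zero, mul_assoc H]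
    have h : ∀ l, (H * (symbol (g x) j * F).deriv).toFun l =
        (H * (symbol (g x) j * F.deriv)).toFun l +
          (H * (symbol (g x) (j + 1) * F)).toFun l := fun l => by
      rw [mul_toFun, SymmFamily.deriv_mul, mul_add, symbol_succ, add_comm]
      rfl
    rw [eval_congr h, mul_comm F]
    simp only [mul_assoc]
    abel

theorem evalPair_toPair (hp : IsDiffMonomial g p F l) :
    evalPair N k (toPair k g p) = F.eval l := by
  rw [hp.toPair_eq, evalPair_pair]

/-- With `(F, a :: l)` and `(G, b :: l')` the data of `p` and `q`, the left side is `F l` applied to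
`G.deriv (a :: l') b + G l' (a * b) + lieSum a G l' b`. The definition of the derivative collapses
this to `a * G l' b`, and `F l` can be pulled out of the left factor of a product. -/
theorem evalPair_mul_diff (hp : IsDiffMonomial g p F l) (hq : IsDiffMonomial g q G l')
    (hl : l.length = F.deg + 1) (hl' : l'.length = G.deg + 1) :
    evalPair N k (toPair k g (p * diff k X q)) =
      evalPair N k (toPair k g p) * evalPair N k (toPair k g q) := by
  rw [hp.evalPair_toPair, hq.evalPair_toPair, map_mul, hp.toPair_eq, hq.evalPair_diff]
  obtain ⟨a, l, rfl⟩ := List.exists_cons_of_length_eq_add_one hl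
  obtain ⟨b, l', rfl⟩ := List.exists_cons_of_length_eq_add_one hl'
  rw [List.length_cons, add_left_inj] at hl hl'
  -- The weight condition on `p` makes `l` exactly long enough to fill `F`. The remaining elements
  -- may be distributed freely: one of them becomes the argument `c`, the others the entries of `K`.
  have key : ∀ (K : SymmFamily N) (c : N) (m : List N) (M : Multiset N),
      M = ((c :: (l ++ m) : List N) : Multiset N) →
      (F * K).eval M = F.toFun l (K.toFun m c) := by
    rintro K c m M rfl
    rw [eval_cons, mul_toFun_append _ _ hl, end_mul_apply]
  have h₁ : (F * G.deriv).eval (((a :: l : List N) : Multiset N) + ((b :: l' : List N))) =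
      F.toFun l (G.deriv.toFun (a :: l') b) := by
    refine key _ _ _ _ ?_
    simp only [← Multiset.cons_coe, ← Multiset.coe_add, Multiset.add_cons, Multiset.cons_add]
  have hs : ∀ u m, m.length = G.deg → (G * symbol u 0).toFun m = G.toFun m * rmul u := by
    intro u m hm
    have := mul_toFun_append G (symbol u 0) (l' := []) hm
    rwa [List.append_nil] at this
  -- When `b` is the differentiated factor, `a` serves as the argument. In `h₁` and `h₃` the
  -- argument is `b`, and `a` becomes an entry.
  have h₂ : (F * G * symbol b 0).eval (((a :: l : List N) : Multiset N) + (l' : List N)) =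
      F.toFun l (G.toFun l' (a * b)) := by
    rw [mul_assoc, key (G * symbol b 0) a l' (_ + _) rfl, hs _ _ hl']
    rfl
  have h₃ : delSum (fun u m => (F * G * symbol u 0).eval
      (((a :: l : List N) : Multiset N) + ((b :: m : List N)))) l' =
        F.toFun l (lieSum a G.toFun l' b) := by
    have := map_delSum (AddMonoidHom.mk' (fun r : AddMonoid.End N => F.toFun l (r b))
      (fun r s => by rw [end_add_apply, map_add])) (fun u m => G.toFun (a :: m) * rmul u) l'
    rw [G.isSymm.delSum_rmul] at this
    refine Eq.trans (delSum_congr l' fun u m hm => ?_) this.symm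
    rw [mul_assoc, key (G * symbol u 0) b (a :: m), hs _ (a :: m) (hm.trans hl')]
    · rfl
    · simp only [← Multiset.cons_coe, ← Multiset.coe_add, Multiset.add_cons, Multiset.cons_add]
  simp only [delSum]
  rw [h₁, h₂, h₃, eval_cons, eval_cons, rightOps_mul (F.isSymm.mem l), ← map_add, ← map_add]
  congr 1
  change (ad a (G.toFun l') - lieSum a G.toFun l') b + _ = _
  rw [end_sub_apply, ad_apply]
  abel

end IsDiffMonomial

variable [IsScalarTower k N N] [SMulCommClass k N N]

theorem evalPair_mul_diff {g : X → N} {p q : MvPolynomial (X × ℕ) k}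
    (hp : p ∈ weightNegOne k g) (hq : q ∈ weightNegOne k g) :
    evalPair N k (toPair k g (p * diff k X q)) =
      evalPair N k (toPair k g p) * evalPair N k (toPair k g q) := by
  induction hp using Submodule.span_induction with
  | zero => simp
  | add x y _ _ hx hy => simp only [add_mul, map_add, hx, hy]
  | smul c x _ hx => simp only [smul_mul_assoc, map_smul, hx]
  | mem p hp =>
    obtain ⟨F, l, hp, hl⟩ := hp
    induction hq using Submodule.span_induction with
    | zero => simp
    | add x y _ _ hx hy => simp only [mul_add, map_add, hx, hy]
    | smul c x _ hx => simp only [Derivation.map_smul, mul_smul_comm, map_smul, hx]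
    | mem q hq =>
      obtain ⟨G, l', hq, hl'⟩ := hq
      exact hp.evalPair_mul_diff hq hl hl'

/-- A nonassociative word in a Novikov algebra can be recovered from the corresponding
differential polynomial. -/
theorem evalPair_diffWord (g : X → N) (w : FreeMagma X) : diffWord k w ∈ weightNegOne k g ∧
    evalPair N k (toPair k g (diffWord k w)) = FreeMagma.lift g w := by
  induction w with
  | ih1 x =>
    have h : IsDiffMonomial g (MvPolynomial.X (x, 0) : MvPolynomial (X × ℕ) k) 1 [g x] := by
      simpa using (IsDiffMonomial.one (k := k) (g := g)).zero x
    exact ⟨Submodule.subset_span ⟨_, _, h, rfl⟩, h.evalPair_toPair⟩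
  | ih2 u v hu hv =>
    refine ⟨mul_diff_mem hu.1 hv.1, ?_⟩
    rw [map_mul, ← hu.2, ← hv.2]
    exact evalPair_mul_diff hu.1 hv.1

end DiffPoly

end IsNovikov

/-! ### Extension of scalars in a multilinear variety -/

section Tensor

open TensorProduct

variable {k : Type u} [Field k]

/-- Additivity in one variable needs that variable to occur exactly once. At a product it occurs in
just one factor, and the companion statement says that the other factor does not change. -/
theorem FreeMagma.lift_update_add {X : Type} [DecidableEq X] {B : Type*}
    [NonUnitalNonAssocRing B] (a : X → B) (i : X) (w : FreeMagma X) :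
    (i ∉ w.leaves → ∀ x, FreeMagma.lift (Function.update a i x) w = FreeMagma.lift a w) ∧
    (i ∈ w.leaves → w.leaves.Nodup → ∀ x y, FreeMagma.lift (Function.update a i (x + y)) w =
      FreeMagma.lift (Function.update a i x) w + FreeMagma.lift (Function.update a i y) w) := by
  induction w with
  | ih1 j =>
    constructor
    · intro h x
      have : j ≠ i := fun e => h (by simp [FreeMagma.leaves, e])
      simp [this]
    · intro h _ x y
      have : i = j := Multiset.mem_singleton.1 h
      subst this
      simp
  | ih2 u v hu hv =>
    simp only [FreeMagma.leaves_mul, Multiset.mem_add, not_or, map_mul]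
    constructor
    · rintro ⟨h1, h2⟩ x
      rw [hu.1 h1 x, hv.1 h2 x]
    · intro h hn x y
      obtain ⟨hnu, hnv, hd⟩ := Multiset.nodup_add.1 hn
      rcases h with h | h
      · have h' := Multiset.disjoint_left.1 hd h
        rw [hu.2 h hnu, add_mul, hv.1 h', hv.1 h', hv.1 h']
      · have h' := fun h' => Multiset.disjoint_left.1 hd h' h
        rw [hv.2 h hnv, mul_add, hu.1 h', hu.1 h', hu.1 h']

theorem FreeNonUnitalNonAssocAlgebra.lift_freeMagma_lift {X : Type} {B : Type*}
    [NonUnitalNonAssocRing B] [Module k B] [IsScalarTower k B B] [SMulCommClass k B B]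
    (a : X → B) (w : FreeMagma X) :
    FreeNonUnitalNonAssocAlgebra.lift k a
      (FreeMagma.lift (FreeNonUnitalNonAssocAlgebra.of k) w) = FreeMagma.lift a w := by
  induction w with
  | ih1 x => exact FreeNonUnitalNonAssocAlgebra.lift_of_apply k a x
  | ih2 u v hu hv => rw [map_mul, map_mul, map_mul, hu, hv]

theorem multilinearSpan_lift_update_add {X : Type} [DecidableEq X] {B : Type*}
    [NonUnitalNonAssocRing B] [Module k B] [IsScalarTower k B B] [SMulCommClass k B B]
    {f : FreeNonUnitalNonAssocAlgebra k X}
    (hf : f ∈ multilinearSpan k (FreeNonUnitalNonAssocAlgebra.of k)) (a : X → B) (i : X)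
    (x y : B) : FreeNonUnitalNonAssocAlgebra.lift k (Function.update a i (x + y)) f =
      FreeNonUnitalNonAssocAlgebra.lift k (Function.update a i x) f +
        FreeNonUnitalNonAssocAlgebra.lift k (Function.update a i y) f := by
  induction hf using Submodule.span_induction with
  | zero => simp
  | add p q _ _ hp hq => rw [map_add, map_add, map_add, hp, hq]; abel
  | smul c p _ hp => rw [map_smul, map_smul, map_smul, hp, smul_add]
  | mem p hp =>
    obtain ⟨w, hw, rfl⟩ := hp
    simp only [FreeNonUnitalNonAssocAlgebra.lift_freeMagma_lift]
    exact (FreeMagma.lift_update_add a i w).2 (hw.2 i) hw.1 x y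

variable {A : Type*} [NonUnitalNonAssocRing A] [Module k A] [IsScalarTower k A A]
  [SMulCommClass k A A] {C : Type*} [CommRing C] [Algebra k C]

theorem FreeMagma.lift_tmul {X : Type} (a : X → A) (c : X → C) (w : FreeMagma X) :
    FreeMagma.lift (fun x => a x ⊗ₜ[k] c x) w =
      FreeMagma.lift a w ⊗ₜ[k] (w.leaves.map c).prod := by
  induction w with
  | ih1 x => simp [FreeMagma.leaves]
  | ih2 u v hu hv =>
    rw [map_mul, map_mul, hu, hv, Algebra.TensorProduct.tmul_mul_tmul, FreeMagma.leaves_mul,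
      Multiset.map_add, Multiset.prod_add]

/-- All multilinear words use the same multiset of variables, so by commutativity of `C` they
contribute the same scalar factor, which can be taken out of the whole polynomial. -/
theorem multilinearSpan_lift_tmul {X : Type} [Finite X] {f : FreeNonUnitalNonAssocAlgebra k X}
    (hf : f ∈ multilinearSpan k (FreeNonUnitalNonAssocAlgebra.of k)) (a : X → A) (c : X → C) :
    FreeNonUnitalNonAssocAlgebra.lift k (fun x => a x ⊗ₜ[k] c x) f =
      FreeNonUnitalNonAssocAlgebra.lift k a f ⊗ₜ[k] ((univMultiset X).map c).prod := by
  induction hf using Submodule.span_induction with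
  | zero => simp
  | add p q _ _ hp hq => rw [map_add, map_add, hp, hq, TensorProduct.add_tmul]
  | smul d p _ hp => rw [map_smul, map_smul, hp, TensorProduct.smul_tmul']
  | mem p hp =>
    obtain ⟨w, hw, rfl⟩ := hp
    have : w.leaves = univMultiset X :=
      (Multiset.Nodup.ext hw.1 (nodup_univMultiset X)).2 fun x => by
        simp [hw.2 x, mem_univMultiset x]
    rw [FreeNonUnitalNonAssocAlgebra.lift_freeMagma_lift,
      FreeNonUnitalNonAssocAlgebra.lift_freeMagma_lift, FreeMagma.lift_tmul, this]

theorem multilinearSpan_lift_tensor_eq_zero {X : Type} [Finite X]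
    {f : FreeNonUnitalNonAssocAlgebra k X}
    (hf : f ∈ multilinearSpan k (FreeNonUnitalNonAssocAlgebra.of k))
    (h : ∀ a : X → A, FreeNonUnitalNonAssocAlgebra.lift k a f = 0) (a : X → A ⊗[k] C) :
    FreeNonUnitalNonAssocAlgebra.lift k a f = 0 := by
  classical
  -- Induction on a set `s` of positions outside of which the arguments are pure tensors; additivity
  -- in a single variable removes one position at a time.
  suffices H : ∀ (s : Finset X) (a : X → A ⊗[k] C), (∀ i ∉ s, ∃ b c, a i = b ⊗ₜ[k] c) →
      FreeNonUnitalNonAssocAlgebra.lift k a f = 0 by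
    have := Fintype.ofFinite X
    exact H Finset.univ a fun i hi => absurd (Finset.mem_univ i) hi
  intro s
  induction s using Finset.induction_on with
  | empty =>
    intro a ha
    choose b c hbc using fun i => ha i (Finset.notMem_empty i)
    rw [funext hbc, multilinearSpan_lift_tmul hf, h, TensorProduct.zero_tmul]
  | insert i s _ ih =>
    intro a ha
    rw [← Function.update_eq_self i a]
    have pure : ∀ b c, FreeNonUnitalNonAssocAlgebra.lift k
        (Function.update a i (b ⊗ₜ[k] c)) f = 0 := by
      intro b c
      refine ih _ fun j hj => ?_
      rcases eq_or_ne j i with rfl | hji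
      · exact ⟨b, c, by simp⟩
      · obtain ⟨b', c', h'⟩ := ha j (by simp [hji, hj])
        exact ⟨b', c', by simp [hji, h']⟩
    induction a i using TensorProduct.induction_on with
    | zero => simpa only [TensorProduct.zero_tmul] using pure 0 0
    | tmul b c => exact pure b c
    | add x y hx hy => rw [multilinearSpan_lift_update_add hf, hx, hy, add_zero]

/-- A multilinear variety is closed under extension by a commutative associative algebra. -/
theorem MultilinearVariety.Mem.tensor {V : MultilinearVariety k} (hA : V.Mem A) :
    V.Mem (A ⊗[k] C) := fun n f hf a =>
  multilinearSpan_lift_tensor_eq_zero (V.multilinear n f hf) (hA n f hf) a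

/-- A derivation of the commutative factor extends to the tensor product. -/
theorem lTensor_derivation (d : Derivation k C C) (x y : A ⊗[k] C) :
    (d : C →ₗ[k] C).lTensor A (x * y) =
      (d : C →ₗ[k] C).lTensor A x * y + x * (d : C →ₗ[k] C).lTensor A y := by
  induction x using TensorProduct.induction_on with
  | zero => simp
  | add x x' hx hx' => simp only [add_mul, map_add, hx, hx']; abel
  | tmul a b =>
    induction y using TensorProduct.induction_on with
    | zero => simp
    | add x x' hx hx' => simp only [mul_add, map_add, hx, hx']; abel
    | tmul a' b' =>
      simp only [LinearMap.lTensor_tmul, Algebra.TensorProduct.tmul_mul_tmul,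
        Derivation.coeFn_coe, Derivation.leibniz, TensorProduct.tmul_add, smul_eq_mul]
      rw [add_comm, mul_comm b']

end Tensor

/-! ### Compositions with a binary operation in an operad -/

namespace SymmOperad

variable {k : Type u} [Field k]

/-- The bijection sending `0` to the ordinary point and `1` to the distinguished point. -/
def finTwoEquivOption : Fin 2 ≃ Option Unit where
  toFun := ![some (), none]
  invFun o := o.elim 1 fun _ => 0
  left_inv := by intro i; fin_cases i <;> rfl
  right_inv := by rintro (_ | _) <;> rfl

/-- The composition of a binary operation with two operations. -/
def binaryComp (P : SymmOperad k) {I J : Type} [Finite I] [Finite J] (μ : P.obj (Fin 2))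
    (p : P.obj I) (q : P.obj J) : P.obj (I ⊕ J) :=
  P.map (Equiv.sumComm J I) (P.comp (P.map ((Equiv.sumComm Unit J).trans (sumUnitEquivOption J))
    (P.comp (P.map finTwoEquivOption μ) q)) p)

/-- In `binaryComp` the operation `q` is inserted first, at input `1`, and `p` then at the remaining
input `0`; the relabellings restore the order of the inputs. -/
theorem Alg.act_binaryComp {P : SymmOperad k} {A : Type v} [AddCommGroup A] [Module k A]
    (α : P.Alg A) {I J : Type} [Finite I] [Finite J] (μ : P.obj (Fin 2))
    (p : P.obj I) (q : P.obj J) (a : I ⊕ J → A) : α.act (P.binaryComp μ p q) a =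
      α.act μ ![α.act p fun i => a (.inl i), α.act q fun j => a (.inr j)] := by
  simp only [binaryComp, α.act_map, α.act_comp]
  congr 1
  funext i
  fin_cases i <;> rfl

theorem hadamard_binaryComp (P Q : SymmOperad k) {I J : Type} [Finite I] [Finite J]
    (μ : P.obj (Fin 2)) (ν : Q.obj (Fin 2)) (p : P.obj I) (p' : Q.obj I) (q : P.obj J)
    (q' : Q.obj J) :
    (hadamard P Q).binaryComp (TensorProduct.tmul k μ ν) (TensorProduct.tmul k p p')
      (TensorProduct.tmul k q q') =
        TensorProduct.tmul k (P.binaryComp μ p q) (Q.binaryComp ν p' q') := rfl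

end SymmOperad

namespace MultilinearVariety

variable {k : Type u} [Field k] (V : MultilinearVariety k)

theorem operad_map_val {I J : Type} [Finite I] [Finite J] (e : I ≃ J) (p : V.operad.obj I) :
    (V.operad.map e p).1 = Free.subst (fun i => Free.of (e i)) p.1 := rfl

theorem operad_comp_val {I J : Type} [Finite I] [Finite J] (p : V.operad.obj (Option I))
    (q : V.operad.obj J) : (V.operad.comp p q).1 = Free.subst (insertion q.1) p.1 := rfl

theorem operad_binaryComp_val {I J : Type} [Finite I] [Finite J] (μ : V.operad.obj (Fin 2))
    (p : V.operad.obj I) (q : V.operad.obj J) : (V.operad.binaryComp μ p q).1 =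
      Free.subst ![Free.subst (fun i => Free.of (.inl i)) p.1,
        Free.subst (fun j => Free.of (.inr j)) q.1] μ.1 := by
  simp only [SymmOperad.binaryComp, operad_map_val, operad_comp_val, Free.subst_subst]
  congr 2
  funext i
  fin_cases i <;>
    simp [SymmOperad.finTwoEquivOption, insertion, Free.subst_subst, sumUnitEquivOption]

theorem binaryComp_mul₁₂_val {I J : Type} [Finite I] [Finite J] (p : V.operad.obj I)
    (q : V.operad.obj J) : (V.operad.binaryComp V.mul₁₂ p q).1 =
      Free.subst (fun i => Free.of (.inl i)) p.1 * Free.subst (fun j => Free.of (.inr j)) q.1 := by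
  rw [operad_binaryComp_val]
  change Free.subst _ (Free.of 0 * Free.of 1) = _
  simp

theorem binaryComp_mul₂₁_val {I J : Type} [Finite I] [Finite J] (p : V.operad.obj I)
    (q : V.operad.obj J) : (V.operad.binaryComp V.mul₂₁ p q).1 =
      Free.subst (fun j => Free.of (.inr j)) q.1 * Free.subst (fun i => Free.of (.inl i)) p.1 := by
  rw [operad_binaryComp_val]
  change Free.subst _ (Free.of 1 * Free.of 0) = _
  simp

end MultilinearVariety

/-! ### The two words underlying a word in two operations -/

namespace BiWord

variable {X : Type}

/-- The word obtained by reading both operations as the product. -/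
def varWord : BiWord X → FreeMagma X
  | var x => .of x
  | prec a b => a.varWord * b.varWord
  | succ a b => a.varWord * b.varWord

/-- The word obtained by reading `≺` as the product and `≻` as the opposite product. -/
def novWord : BiWord X → FreeMagma X
  | var x => .of x
  | prec a b => a.novWord * b.novWord
  | succ a b => b.novWord * a.novWord

-- Both `≺` and `≻` multiply the first components in the given order. In the second components they
-- give `u v'` and `u' v`, and the latter is the product `v ∘ u`, which is why `novWord` reverses
-- the factors at `≻`.
open TensorProduct in
theorem eval_tensor {k : Type u} [Field k] {A : Type*} [NonUnitalNonAssocRing A] [Module k A]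
    [IsScalarTower k A A] [SMulCommClass k A A] (g : X → A) (w : BiWord X) :
    w.eval (fun a b => a * ((IsNovikov.diff k X : _ →ₗ[k] _).lTensor A b))
      (fun a b => (IsNovikov.diff k X : _ →ₗ[k] _).lTensor A a * b)
      (fun x => g x ⊗ₜ[k] (MvPolynomial.X (x, 0) : MvPolynomial (X × ℕ) k)) =
    FreeMagma.lift g w.varWord ⊗ₜ[k] IsNovikov.diffWord k w.novWord := by
  induction w with
  | var x => rfl
  | prec u v hu hv =>
    simp only [eval, hu, hv, varWord, novWord, map_mul, LinearMap.lTensor_tmul,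
      Algebra.TensorProduct.tmul_mul_tmul]
    rfl
  | succ u v hu hv =>
    simp only [eval, hu, hv, varWord, novWord, map_mul, LinearMap.lTensor_tmul,
      Algebra.TensorProduct.tmul_mul_tmul]
    -- The reversal in `novWord` is absorbed by commutativity of the differential polynomials.
    exact congrArg _ (mul_comm _ _)

end BiWord

/-! ### Realising words in two operations inside the white product -/

namespace MultilinearVariety

open TensorProduct

variable {k : Type u} [Field k]

instance novikov_free_isNovikov (X : Type) : IsNovikov ((novikov k).Free X) where
  left_symm a b c := by
    have := Free.mem (V := novikov k) (X := X) 3 _ ⟨rfl, Or.inl rfl⟩ ![a, b, c]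
    simpa [sub_eq_zero] using this
  right_comm a b c := by
    have := Free.mem (V := novikov k) (X := X) 3 _ ⟨rfl, Or.inr rfl⟩ ![a, b, c]
    simpa [sub_eq_zero] using this

variable (V : MultilinearVariety k)

/-- The inclusion of `Var(I) ⊗ Nov(I)` into the tensor product of the free algebras. -/
noncomputable def hadamardIncl (I : Type) [Finite I] :
    (SymmOperad.hadamard V.operad (novikov k).operad).obj I →ₗ[k]
      V.Free I ⊗[k] (novikov k).Free I :=
  TensorProduct.map (multilinearSpan k (Free.of : I → V.Free I)).subtype
    (multilinearSpan k (Free.of : I → (novikov k).Free I)).subtype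

/-- Vector spaces are flat. Relations may therefore be checked in the tensor product of the full
free algebras, where evaluation and the recovery of Novikov words take place. -/
theorem hadamardIncl_injective (I : Type) [Finite I] :
    Function.Injective (V.hadamardIncl I) :=
  TensorProduct.map_injective_of_flat_flat _ _ (Submodule.subtype_injective _)
    (Submodule.subtype_injective _)

variable {V} {A : Type v} [AddCommGroup A] [Module k A] (α : V.whiteNov.Alg A) {X : Type}

/-- A word in two operations comes from an operation of `Var ∘ Nov` with inputs labelled by its
leaves. -/
theorem exists_labelled_operation (w : BiWord X) :
    ∃ (I : Type) (_ : Finite I) (lab : I → X) (t : V.whiteNov.obj I) (p : V.operad.obj I)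
      (q : (novikov k).operad.obj I), (univMultiset I).map lab = w.leaves ∧
      t.1 = p ⊗ₜ[k] q ∧
      Free.subst (fun i => Free.of (lab i)) p.1 = FreeMagma.lift Free.of w.varWord ∧
      Free.subst (fun i => Free.of (lab i)) q.1 = FreeMagma.lift Free.of w.novWord ∧
      ∀ a : X → A, α.act t (fun i => a (lab i)) =
        w.eval (fun a b => α.act V.precOp ![a, b]) (fun a b => α.act V.succOp ![a, b]) a := by
  have huniv : ∀ (I J : Type) [Finite I] [Finite J], univMultiset (I ⊕ J) =
      (univMultiset I).map Sum.inl + (univMultiset J).map Sum.inr := by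
    intro I J _ _
    refine (Multiset.Nodup.ext (nodup_univMultiset _) ?_).2 ?_
    · rw [Multiset.nodup_add]
      refine ⟨(nodup_univMultiset I).map Sum.inl_injective,
        (nodup_univMultiset J).map Sum.inr_injective, ?_⟩
      simp [Multiset.disjoint_left]
    · rintro (i | j) <;> simp [mem_univMultiset]
  -- A subword of a multilinear word misses some of the variables, so multilinearity does not
  -- survive the induction. Inputs are therefore labelled by the leaves, and `lab` records the
  -- variable at each leaf.
  induction w with
  | var x =>
    refine ⟨Unit, inferInstance, fun _ => x, V.whiteNov.one, V.operad.one, (novikov k).operad.one,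
      ?_, rfl, Free.subst_of _ _, Free.subst_of _ _, fun a => α.act_one _⟩
    have : univMultiset Unit = {()} :=
      (Multiset.Nodup.ext (nodup_univMultiset _) (Multiset.nodup_singleton _)).2
        fun _ => by simp [mem_univMultiset]
    rw [this]
    rfl
  | prec u v hu hv =>
    obtain ⟨I, _, lab, t, p, q, hl, ht, hp, hq, ha⟩ := hu
    obtain ⟨I', _, lab', t', p', q', hl', ht', hp', hq', ha'⟩ := hv
    refine ⟨I ⊕ I', inferInstance, Sum.elim lab lab', V.whiteNov.binaryComp V.precOp t t',
      V.operad.binaryComp V.mul₁₂ p p', (novikov k).operad.binaryComp (novikov k).mul₁₂ q q',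
      ?_, ?_, ?_, ?_, ?_⟩
    · simp [huniv, Multiset.map_map, Function.comp_def, hl, hl', BiWord.leaves]
    · rw [← SymmOperad.hadamard_binaryComp, ← ht, ← ht']
      rfl
    · simp [binaryComp_mul₁₂_val, Free.subst_subst, hp, hp', BiWord.varWord]
    · simp [binaryComp_mul₁₂_val, Free.subst_subst, hq, hq', BiWord.novWord]
    · intro a
      rw [α.act_binaryComp, BiWord.eval, ← ha, ← ha']
      rfl
  | succ u v hu hv =>
    obtain ⟨I, _, lab, t, p, q, hl, ht, hp, hq, ha⟩ := hu
    obtain ⟨I', _, lab', t', p', q', hl', ht', hp', hq', ha'⟩ := hv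
    refine ⟨I ⊕ I', inferInstance, Sum.elim lab lab', V.whiteNov.binaryComp V.succOp t t',
      V.operad.binaryComp V.mul₁₂ p p', (novikov k).operad.binaryComp (novikov k).mul₂₁ q q',
      ?_, ?_, ?_, ?_, ?_⟩
    · simp [huniv, Multiset.map_map, Function.comp_def, hl, hl', BiWord.leaves]
    · rw [← SymmOperad.hadamard_binaryComp, ← ht, ← ht']
      rfl
    · simp [binaryComp_mul₁₂_val, Free.subst_subst, hp, hp', BiWord.varWord]
    · simp [binaryComp_mul₂₁_val, Free.subst_subst, hq, hq', BiWord.novWord]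
    · intro a
      rw [α.act_binaryComp, BiWord.eval, ← ha, ← ha']
      rfl

/-- A multilinear word in two operations comes from an operation of `Var ∘ Nov`. -/
theorem exists_operation [Finite X] {w : BiWord X} (hw : w.IsMultilinear) :
    ∃ t : V.whiteNov.obj X, V.hadamardIncl X t.1 =
        FreeMagma.lift Free.of w.varWord ⊗ₜ[k] FreeMagma.lift Free.of w.novWord ∧
      ∀ a : X → A, α.act t a =
        w.eval (fun a b => α.act V.precOp ![a, b]) (fun a b => α.act V.succOp ![a, b]) a := by
  obtain ⟨I, _, lab, t, p, q, hl, ht, hp, hq, ha⟩ := exists_labelled_operation α w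
  -- For a multilinear word each variable sits at exactly one leaf, so the operation on leaves can
  -- be relabelled to one on `X`.
  have hbij : Function.Bijective lab := by
    constructor
    · intro i j h
      have := hw.1
      rw [← hl] at this
      exact Multiset.inj_on_of_nodup_map this _ (mem_univMultiset i) _ (mem_univMultiset j) h
    · intro x
      have := hw.2 x
      rw [← hl] at this
      obtain ⟨i, _, h⟩ := Multiset.mem_map.1 this
      exact ⟨i, h⟩
  refine ⟨V.whiteNov.map (Equiv.ofBijective lab hbij) t, ?_, fun a => ?_⟩
  · have : (V.whiteNov.map (Equiv.ofBijective lab hbij) t).1 =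
        V.operad.map (Equiv.ofBijective lab hbij) p ⊗ₜ[k]
          (novikov k).operad.map (Equiv.ofBijective lab hbij) q :=
      congrArg ((SymmOperad.hadamard V.operad (novikov k).operad).map
        (Equiv.ofBijective lab hbij)) ht
    rw [this, ← hp, ← hq]
    rfl
  · rw [α.act_map, ← ha]
    rfl

end MultilinearVariety

/-! ### From derived identities to relations between operations -/

section DerivedIdentity

open TensorProduct

variable {k : Type u} [Field k] {V : MultilinearVariety k} {X : Type} {f : BiPoly k X}

theorem BiPoly.IsDerivedIdentity.eval_tensor_eq_zero (hd : f.IsDerivedIdentity V)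
    {A C : Type u} [NonUnitalNonAssocRing A] [Module k A] [IsScalarTower k A A]
    [SMulCommClass k A A] [CommRing C] [Algebra k C] (hA : V.Mem A) (d : Derivation k C C)
    (x : X → A ⊗[k] C) : f.eval (fun a b => a * (d : C →ₗ[k] C).lTensor A b)
      (fun a b => (d : C →ₗ[k] C).lTensor A a * b) x = 0 :=
  hd (A ⊗[k] C) hA.tensor ((d : C →ₗ[k] C).lTensor A) (lTensor_derivation d) x

theorem BiPoly.IsDerivedIdentity.sum_tmul_diffWord_eq_zero (hd : f.IsDerivedIdentity V)
    {A : Type u} [NonUnitalNonAssocRing A] [Module k A] [IsScalarTower k A A]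
    [SMulCommClass k A A] (hA : V.Mem A) (g : X → A) :
    f.sum (fun w c => c • (FreeMagma.lift g w.varWord ⊗ₜ[k] IsNovikov.diffWord k w.novWord)) =
      0 := by
  rw [← hd.eval_tensor_eq_zero hA (IsNovikov.diff k X)
    fun x => g x ⊗ₜ[k] MvPolynomial.X (x, 0)]
  exact Finsupp.sum_congr fun w _ => by rw [BiWord.eval_tensor]

/-- The tensors corresponding to a derived identity vanish in the tensor product of the free
algebras. -/
theorem BiPoly.IsDerivedIdentity.sum_tmul_eq_zero (hd : f.IsDerivedIdentity V) :
    f.sum (fun w c => c • ((FreeMagma.lift MultilinearVariety.Free.of w.varWord : V.Free X) ⊗ₜ[k]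
      (FreeMagma.lift MultilinearVariety.Free.of w.novWord : (novikov k).Free X))) = 0 := by
  have h := hd.sum_tmul_diffWord_eq_zero MultilinearVariety.Free.mem
    (MultilinearVariety.Free.of : X → V.Free X)
  let g : X → (novikov k).Free X := MultilinearVariety.Free.of
  -- The recovery map is linear on all differential polynomials, so it can be applied to the second
  -- tensor factor alone, taking the relation over `C` to one over the free Novikov algebra.
  have h' := congrArg (((IsNovikov.evalPair _ k) ∘ₗ
    (IsNovikov.toPair k g).toLinearMap).lTensor (V.Free X)) h
  rw [map_zero, map_finsuppSum] at h'
  rw [← h']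
  refine Finsupp.sum_congr fun w _ => ?_
  rw [map_smul, LinearMap.lTensor_tmul, LinearMap.comp_apply]
  exact congrArg _ (congrArg _ (IsNovikov.evalPair_diffWord g w.novWord).2.symm)

end DerivedIdentity

theorem mainTheorem3 {k : Type u} [Field k] (V : MultilinearVariety k) (n : ℕ)
    (f : BiPoly k (Fin n)) (hf : f.IsMultilinear) (hd : f.IsDerivedIdentity V)
    (A : Type v) [AddCommGroup A] [Module k A] (α : V.whiteNov.Alg A) :
    V.HoldsOnWhite f α := by
  intro x
  choose t ht hact using fun w : f.support => MultilinearVariety.exists_operation α (hf w.1 w.2)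
  have hsum : ∑ w : f.support, f w.1 • t w = 0 := by
    -- A relation in the suboperad is a relation in the Hadamard product, and that is tested in the
    -- tensor product of the free algebras, where `sum_tmul_eq_zero` provides it.
    refine Subtype.ext (V.hadamardIncl_injective (Fin n) ?_)
    have hval : ((∑ w : f.support, f w.1 • t w : V.whiteNov.obj (Fin n))).1 =
        ∑ w : f.support, f w.1 • (t w).1 := by
      exact map_sum (Submodule.subtype ((SymmOperad.hadamard V.operad
        (novikov k).operad).binaryPart.carrier (Fin n))) _ _
    rw [hval, map_sum]
    refine Eq.trans ?_ (hd.sum_tmul_eq_zero.trans (map_zero (V.hadamardIncl (Fin n))).symm)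
    refine Eq.trans (Finset.sum_congr rfl fun w _ => ?_) (Finset.sum_coe_sort f.support _)
    rw [map_smul, ht]
  have h := congrArg (fun s : V.whiteNov.obj (Fin n) => α.act s x) hsum
  simp only [map_sum, map_smul, map_zero, _root_.sum_apply, _root_.smul_apply,
    _root_.zero_apply, hact] at h
  rw [BiPoly.eval, Finsupp.sum, ← Finset.sum_coe_sort]
  exact h
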